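/- **Theorem 4.1.** Let $L$ be a countable relational language and let $\mathcal K$ be a Fraïssé class of finite $L$-structures, i.e. a class of finite $L$-structures with countably many isomorphism types that is hereditary, has joint embedding and amalgamation, and contains structures of size at least $n$ for every $n\in\mathbb N$. Let $F$ be the Fraïssé limit of $\mathcal K$ and let $G_{\mathcal K}=\mathrm{Aut}(F)$, with the topology in which the pointwise stabilizers of finite subsets of $F$ form a neighbourhood basis at the identity. Suppose that $\mathcal K$ is Ramsey, that is, $\mathcal K$ has Ramsey degree $1$: for all $A,B\in\mathcal K$ and all $k\ge 2$ there is $C\in\mathcal K$ such that for every colouring with $k$ colours of the substructures of $C$ isomorphic to $A$ there is a substructure $B'\cong B$ of $C$ all of whose substructures isomorphic to $A$ have the same colour. Let $M(G_{\mathcal K})$ be the universal minimal $G_{\mathcal K}$-flow, i.e. the (up to isomorphism unique) nonempty compact Hausdorff space with a continuous action of $G_{\mathcal K}$ all of whose orbits are dense that admits a continuous $G_{\mathcal K}$-equivariant map into every other such flow. If $G_{\mathcal K}$ is amenable, i.e. there is a $G_{\mathcal K}$-invariant Borel probability measure on $M(G_{\mathcal K})$, then $G_{\mathcal K}$ is uniquely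 ergodic, i.e. there is exactly one $G_{\mathcal K}$-invariant Borel probability measure $\mu$ on $M(G_{\mathcal K})$. Moreover, $M(G_{\mathcal K})$ has exactly one orbit $O$ that is a dense $G_\delta$ set, and $\mu(O)=1$. -/

import Mathlib

open scoped FirstOrder
open CategoryTheory MeasureTheory

universe u v w

/-! ### Fraïssé classes -/

/-- A Fraïssé class of finite structures: Mathlib's `IsFraisse` (nonempty, countably many isomorphism
types, hereditary, joint embedding, amalgamation), all members finite, with members of size at least
`n` for every `n`. -/
structure IsFraisseClass {L : FirstOrder.Language.{u, v}}
    (K : Set (Bundled.{w} L.Structure)) : Prop where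
  isFraisse : FirstOrder.Language.IsFraisse K
  finite : ∀ A ∈ K, Finite A
  unbounded : ∀ n : ℕ, ∃ A ∈ K, n ≤ Nat.card A

/-! ### Ramsey degrees -/

/-- The set of substructures of `B` that are isomorphic to `A`. -/
def copies (L : FirstOrder.Language.{u, v}) (A B : Type w) [L.Structure A] [L.Structure B] :
    Set (L.Substructure B) :=
  {S | Nonempty (S ≃[L] A)}

/-- The partition relation `C → (B)^A_{k,d}`: every colouring of the copies of `A` in `C` with `k`
colours takes at most `d` colours on the copies of `A` inside some copy `B'` of `B` in `C`. -/
def RamseyArrow (L : FirstOrder.Language.{u, v}) (k d : ℕ) (A B C : Type w)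
    [L.Structure A] [L.Structure B] [L.Structure C] : Prop :=
  ∀ χ : copies L A C → Fin k, ∃ B' ∈ copies L B C,
    (χ '' {S | (S : L.Substructure C) ≤ B'}).ncard ≤ d

/-- The Ramsey degree of `A` in `K`: the least `d` such that for all `B ∈ K` and `k ≥ 2` there is
`C ∈ K` with `C → (B)^A_{k,d}`, and `∞` if there is no such `d`. -/
noncomputable def ramseyDegreeIn {L : FirstOrder.Language.{u, v}} (K : Set (Bundled.{w} L.Structure))
    (A : Bundled.{w} L.Structure) : ℕ∞ :=
  ⨅ (d : ℕ) (_ : ∀ B ∈ K, ∀ k : ℕ, 2 ≤ k → ∃ C ∈ K, RamseyArrow L k d A B C), (d : ℕ∞)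

/-- The Ramsey degree of a class of structures. -/
noncomputable def ramseyDegree {L : FirstOrder.Language.{u, v}} (K : Set (Bundled.{w} L.Structure)) : ℕ∞ :=
  ⨆ A ∈ K, ramseyDegreeIn K A

/-- A class is Ramsey if its Ramsey degree is `1`. -/
def IsRamsey {L : FirstOrder.Language.{u, v}} (K : Set (Bundled.{w} L.Structure)) : Prop :=
  ramseyDegree K = 1

/-! ### The automorphism group as a topological group -/

/-- Automorphisms form a group under composition. -/
instance autGroup (L : FirstOrder.Language.{u, v}) (F : Type w) [L.Structure F] : Group (F ≃[L] F) where
  mul f g := f.comp g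
  one := FirstOrder.Language.Equiv.refl L F
  inv f := f.symm
  mul_assoc _ _ _ := rfl
  one_mul _ := rfl
  mul_one _ := rfl
  inv_mul_cancel f := by
    apply FirstOrder.Language.Equiv.ext
    intro x
    exact f.symm_apply_apply x

/-- The topology of pointwise convergence, `F` being discrete. The pointwise stabilizers of finite
sets form a basis of neighbourhoods of the identity. -/
instance autTopology (L : FirstOrder.Language.{u, v}) (F : Type w) [L.Structure F] :
    TopologicalSpace (F ≃[L] F) :=
  TopologicalSpace.induced (fun g => (g : F → F)) (@Pi.topologicalSpace F (fun _ => F) fun _ => ⊥)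

/-! ### Flows -/

/-- A `G`-flow: a continuous action of `G` on a compact Hausdorff space. -/
structure IsFlow (G X : Type*) [Group G] [TopologicalSpace G] [TopologicalSpace X]
    [MulAction G X] : Prop where
  compact : CompactSpace X
  hausdorff : T2Space X
  continuous_smul : ContinuousSMul G X

/-- A minimal `G`-flow: a nonempty flow in which every orbit is dense. -/
structure IsMinimalFlow (G X : Type*) [Group G] [TopologicalSpace G] [TopologicalSpace X]
    [MulAction G X] : Prop extends IsFlow G X where
  nonempty : Nonempty X
  minimal : MulAction.IsMinimal G X

/-- `X` is a universal minimal `G`-flow: a minimal flow with a homomorphism into every minimal flow.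
Minimal flows are continuous images of the space of ultrafilters on `G`, so those in the universe
of `G` represent all of them. -/
structure IsUniversalMinimalFlow (G X : Type w) [Group G] [TopologicalSpace G]
    [TopologicalSpace X] [MulAction G X] : Prop extends IsMinimalFlow G X where
  universal : ∀ (Y : Type w) [TopologicalSpace Y] [MulAction G Y], IsMinimalFlow G Y →
    ∃ π : X → Y, Continuous π ∧ ∀ (g : G) (x : X), π (g • x) = g • π x

open MulAction in
/-- Every nonempty flow contains a minimal subflow. -/
theorem IsFlow.exists_minimal {G X : Type*} [Group G] [TopologicalSpace G] [TopologicalSpace X]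
    [MulAction G X] (h : IsFlow G X) [Nonempty X] :
    ∃ Z : SubMulAction G X, IsMinimalFlow G Z := by
  have := h.compact
  have := h.hausdorff
  have := h.continuous_smul
  let S : Set (Set X) := {C | IsClosed C ∧ C.Nonempty ∧ ∀ (g : G), ∀ x ∈ C, g • x ∈ C}
  have hzorn : ∀ c ⊆ S, IsChain (· ⊆ ·) c → c.Nonempty → ∃ lb ∈ S, ∀ s ∈ c, lb ⊆ s := by
    intro c hcS hc hne
    have := hne.to_subtype
    refine ⟨⋂₀ c, ⟨isClosed_sInter fun s hs => (hcS hs).1, ?_, ?_⟩,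
      fun s hs => Set.sInter_subset_of_mem hs⟩
    · exact IsCompact.nonempty_sInter_of_directed_nonempty_isCompact_isClosed (S := c)
        (fun a ha b hb => (hc.total ha hb).elim (fun h => ⟨a, ha, subset_rfl, h⟩)
          fun h => ⟨b, hb, h, subset_rfl⟩) (fun s hs => (hcS hs).2.1) (fun s hs => (hcS hs).1.isCompact)
        (fun s hs => (hcS hs).1)
    · intro g x hx s hs
      exact (hcS hs).2.2 g x (hx s hs)
  obtain ⟨C, -, hC⟩ := zorn_superset_nonempty S hzorn Set.univ
    ⟨isClosed_univ, Set.univ_nonempty, fun _ _ _ => Set.mem_univ _⟩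
  refine ⟨⟨C, fun g x hx => hC.1.2.2 g _ hx⟩, ⟨⟨?_, ?_, ?_⟩, ?_, ⟨?_⟩⟩⟩
  · exact isCompact_iff_compactSpace.1 hC.1.1.isCompact
  · exact inferInstanceAs (T2Space C)
  · exact ⟨Continuous.subtype_mk
      (continuous_fst.smul (continuous_subtype_val.comp continuous_snd)) _⟩
  · exact hC.1.2.1.to_subtype
  · rintro ⟨x, hx⟩
    have hsub : closure (orbit G x) ⊆ C :=
      closure_minimal (by rintro _ ⟨g, rfl⟩; exact hC.1.2.2 g x hx) hC.1.1
    have hmem : closure (orbit G x) ∈ S := by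
      refine ⟨isClosed_closure, (nonempty_orbit x).closure, fun g y hy => ?_⟩
      exact smul_closure_orbit_subset g x (Set.smul_mem_smul_set hy)
    have heq : C ⊆ closure (orbit G x) := hC.2 hmem hsub
    intro y
    rw [closure_subtype]
    refine closure_mono ?_ (heq y.2)
    rintro _ ⟨g, rfl⟩
    exact ⟨g • ⟨x, hx⟩, ⟨g, rfl⟩, rfl⟩

/-- Every topological group has a universal minimal flow. -/
theorem exists_isUniversalMinimalFlow (G : Type w) [Group G] [TopologicalSpace G] :
    ∃ (X : Type w) (_ : TopologicalSpace X) (_ : MulAction G X), IsUniversalMinimalFlow G X := by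
  -- representatives of all minimal flows, on quotients of the set of ultrafilters on `G`
  let I : Type w := Σ s : Setoid (Ultrafilter G),
    {p : TopologicalSpace (Quotient s) × MulAction G (Quotient s) //
      @IsMinimalFlow G (Quotient s) _ _ p.1 p.2}
  let P : I → Type w := fun i => Quotient i.1
  let _ : ∀ i, TopologicalSpace (P i) := fun i => i.2.1.1
  let _ : ∀ i, MulAction G (P i) := fun i => i.2.1.2
  have hP : ∀ i, IsMinimalFlow G (P i) := fun i => i.2.2
  have := fun i => (hP i).compact
  have := fun i => (hP i).hausdorff
  have := fun i => (hP i).continuous_smul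
  have := fun i => (hP i).nonempty
  have hF : IsFlow G (∀ i, P i) := ⟨inferInstance, inferInstance,
    ⟨continuous_pi fun i => continuous_fst.smul ((continuous_apply i).comp continuous_snd)⟩⟩
  obtain ⟨Z, hZ⟩ := hF.exists_minimal
  refine ⟨Z, inferInstance, inferInstance, hZ, fun Y _ _ hY => ?_⟩
  have := hY.compact
  have := hY.hausdorff
  have := hY.continuous_smul
  obtain ⟨y⟩ := hY.nonempty
  let f : Ultrafilter G → Y := Ultrafilter.extend fun g : G => g • y
  have hf : Continuous f := continuous_ultrafilter_extend _
  have hsurj : Function.Surjective f := by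
    rw [← Set.range_eq_univ, ← (isCompact_range hf).isClosed.closure_eq]
    refine ((hY.minimal.dense_orbit y).mono ?_).closure_eq
    rintro _ ⟨g, rfl⟩
    exact ⟨pure g, congrFun (ultrafilter_extend_extends fun g : G => g • y) g⟩
  let s : Setoid (Ultrafilter G) := Setoid.ker f
  let e : Quotient s ≃ Y := Setoid.quotientKerEquivOfSurjective f hsurj
  let t : TopologicalSpace (Quotient s) := TopologicalSpace.induced e inferInstance
  let a : MulAction G (Quotient s) := e.mulAction G
  let h : Quotient s ≃ₜ Y := e.toHomeomorphOfIsInducing ⟨rfl⟩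
  have hsm : ∀ (g : G) (q : Quotient s), e (g • q) = g • e q := fun g q =>
    e.apply_symm_apply _
  have hQ : IsMinimalFlow G (Quotient s) := by
    refine ⟨⟨h.symm.compactSpace, h.symm.t2Space, ⟨?_⟩⟩, ⟨e.symm y⟩, ⟨fun q => ?_⟩⟩
    · refine (h.comp_continuous_iff).1 ?_
      have : Continuous fun p : G × Quotient s => p.1 • h p.2 :=
        continuous_fst.smul (h.continuous.comp continuous_snd)
      exact this.congr fun p => (hsm p.1 p.2).symm
    · have := (hY.minimal.dense_orbit (e q)).preimage h.isOpenMap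
      refine this.mono ?_
      rintro q' ⟨g, hg⟩
      exact ⟨g, e.injective ((hsm g q).trans hg)⟩
  let i : I := ⟨s, ⟨(t, a), hQ⟩⟩
  refine ⟨fun z => h ((z : ∀ i, P i) i), ?_, fun g z => hsm g _⟩
  exact h.continuous.comp ((continuous_apply i).comp continuous_subtype_val)

/-- `μ` is a `G`-invariant Borel probability measure on `X`. -/
structure IsInvariantProbability (G : Type*) {X : Type*} [Group G] [MulAction G X]
    [MeasurableSpace X] (μ : Measure X) : Prop where
  isProbability : IsProbabilityMeasure μ
  invariant : SMulInvariantMeasure G X μ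

/-- `O` is an orbit of `G` on `X` that is a dense `G_δ` set. -/
structure IsDenseGδOrbit (G : Type*) {X : Type*} [Group G] [TopologicalSpace X] [MulAction G X]
    (O : Set X) : Prop where
  isOrbit : ∃ x : X, O = MulAction.orbit G x
  dense : Dense O
  isGδ : IsGδ O

/-! Write `G` for the automorphism group. The strict linear orders on `F` form a compact `G`-space,
so universality of `M` yields an equivariant map `lt` from `M` to orders
(`exists_isEquivariantOrder`). The Ramsey property makes finite colourings of the translates of a
finite set constant inside a translate of any given finite set. With compactness and minimality this
forces closed relations on `M` that hold whenever such colours agree to hold everywhere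
(`IsRamseyAction.mem_of_isClosed`). Hence any two of the orders are isomorphic on each finite set
through `G`, finite pieces of them amalgamate, and a point is determined by its order: `M` is a
homogeneous flow of orders (`IsOrderFlow`).

Unique ergodicity is then counting: an invariant probability gives equal mass to all orders that
occur on a finite set. The points with the extension property form a dense `G_δ` set by amalgamation
and Baire, and a single orbit by back and forth.

That this orbit has full measure is the main difficulty. Given the order on `A`, a prescribed
possible position over `A` should be taken by some element of the orbit of `c` under the pointwise
stabilizer of `A`. By `measureReal_agreeOn_le` this has conditional probability at least `1 / 32`.
If `c` has few possible positions (gaps), `c` itself suffices. Otherwise the elements of `G`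
preserving `insert c A` act on ranks through cycles of intervals between gaps, and two such cycles
generate a two-transitive action on the block spanned by the gaps. So the events that different
orbit elements take the position overlap little in pairs, and a Bonferroni estimate bounds their
union from below. As the bound holds over every finite set, the set where an extension fails fills
at most `31 / 32` of each cylinder over a finite set containing `A`, and is null as in a density
argument. -/

namespace OrderFlow

noncomputable section

open scoped Classical

/-! ### Finite ranks in strict linear orders -/

section Rank

variable {F : Type*}

/-- `r` is a strict linear order. -/
structure StrictLinear (r : F → F → Prop) : Prop where
  irrefl : ∀ a, ¬ r a a
  trans : ∀ a b c, r a b → r b c → r a c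
  total : ∀ a b, a ≠ b → r a b ∨ r b a

/-- The relations `r` and `r'` agree on `B`. -/
def AgreeOn (B : Finset F) (r r' : F → F → Prop) : Prop :=
  ∀ a ∈ B, ∀ b ∈ B, (r a b ↔ r' a b)

theorem AgreeOn.refl (B : Finset F) (r : F → F → Prop) : AgreeOn B r r := fun _ _ _ _ => Iff.rfl

theorem AgreeOn.symm {B : Finset F} {r r' : F → F → Prop} (h : AgreeOn B r r') : AgreeOn B r' r :=
  fun a ha b hb => (h a ha b hb).symm

theorem AgreeOn.trans {B : Finset F} {r r' r'' : F → F → Prop} (h : AgreeOn B r r')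
    (h' : AgreeOn B r' r'') : AgreeOn B r r'' :=
  fun a ha b hb => (h a ha b hb).trans (h' a ha b hb)

theorem AgreeOn.mono {A B : Finset F} {r r' : F → F → Prop} (h : AgreeOn B r r') (hAB : A ⊆ B) :
    AgreeOn A r r' :=
  fun a ha b hb => h a (hAB ha) b (hAB hb)

/-- The number of elements of `S` below `u`. -/
def rk (r : F → F → Prop) (S : Finset F) (u : F) : ℕ := (S.filter fun a => r a u).card

theorem rk_congr {r r' : F → F → Prop} {S : Finset F} (h : AgreeOn S r r') {u : F} (hu : u ∈ S) :
    rk r S u = rk r' S u := by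
  unfold rk
  congr 1
  exact Finset.filter_congr fun a ha => h a ha u hu

theorem rk_lt_card {r : F → F → Prop} (hr : StrictLinear r) {S : Finset F} {u : F} (hu : u ∈ S) :
    rk r S u < S.card :=
  Finset.card_lt_card (Finset.filter_ssubset.2 ⟨u, hu, hr.irrefl u⟩)

theorem rk_lt_rk {r : F → F → Prop} (hr : StrictLinear r) {S : Finset F} {u v : F} (hu : u ∈ S)
    (h : r u v) : rk r S u < rk r S v := by
  refine Finset.card_lt_card ((Finset.ssubset_iff_of_subset fun a ha => ?_).2 ⟨u, ?_, ?_⟩)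
  · rw [Finset.mem_filter] at ha ⊢
    exact ⟨ha.1, hr.trans _ _ _ ha.2 h⟩
  · exact Finset.mem_filter.2 ⟨hu, h⟩
  · simp [hr.irrefl u]

theorem rk_le_rk {r : F → F → Prop} (hr : StrictLinear r) {S : Finset F} {u v : F}
    (h : r u v) : rk r S u ≤ rk r S v := by
  refine Finset.card_le_card fun a ha => ?_
  rw [Finset.mem_filter] at ha ⊢
  exact ⟨ha.1, hr.trans _ _ _ ha.2 h⟩

theorem rk_inj {r : F → F → Prop} (hr : StrictLinear r) {S : Finset F} {u v : F} (hu : u ∈ S)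
    (hv : v ∈ S) (h : rk r S u = rk r S v) : u = v := by
  by_contra hne
  rcases hr.total u v hne with h' | h'
  · exact (rk_lt_rk hr hu h').ne h
  · exact (rk_lt_rk hr hv h').ne h.symm

theorem lt_iff_rk {r : F → F → Prop} (hr : StrictLinear r) {S : Finset F} {u v : F} (hu : u ∈ S)
    (hv : v ∈ S) : r u v ↔ rk r S u < rk r S v := by
  refine ⟨rk_lt_rk hr hu, fun h => ?_⟩
  have hne : u ≠ v := by rintro rfl; exact h.false
  exact (hr.total u v hne).resolve_right fun h' => (rk_lt_rk hr hv h').not_gt h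

theorem rk_insert (r : F → F → Prop) {S : Finset F} {c : F} (hc : c ∉ S) (u : F) :
    rk r (insert c S) u = rk r S u + if r c u then 1 else 0 := by
  unfold rk
  rw [Finset.filter_insert]
  split_ifs with h
  · rw [Finset.card_insert_of_notMem]
    simp [hc]
  · rfl

theorem rk_insert_self {r : F → F → Prop} (hr : StrictLinear r) {S : Finset F} {c : F}
    (hc : c ∉ S) : rk r (insert c S) c = rk r S c := by
  simp [rk_insert r hc, hr.irrefl c]

theorem lt_iff_rk_le {r : F → F → Prop} (hr : StrictLinear r) {S : Finset F} {c b : F}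
    (hc : c ∉ S) (hb : b ∈ S) : r c b ↔ rk r S c ≤ rk r S b := by
  refine ⟨rk_le_rk hr, fun h => ?_⟩
  have hne : c ≠ b := by rintro rfl; exact hc hb
  exact (hr.total c b hne).resolve_right fun h' => (rk_lt_rk hr hb h').not_ge h

theorem exists_rk_eq {r : F → F → Prop} (hr : StrictLinear r) (S : Finset F) {i : ℕ}
    (hi : i < S.card) : ∃ u ∈ S, rk r S u = i := by
  have h : S.image (rk r S) = Finset.range S.card := by
    refine Finset.eq_of_subset_of_card_le ?_ ?_
    · intro x hx
      obtain ⟨u, hu, rfl⟩ := Finset.mem_image.1 hx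
      exact Finset.mem_range.2 (rk_lt_card hr hu)
    · rw [Finset.card_image_of_injOn fun u hu v hv h => rk_inj hr hu hv h, Finset.card_range]
  have : i ∈ S.image (rk r S) := by rw [h]; exact Finset.mem_range.2 hi
  simpa using this

/-- A one-point extension of a finite linear order is coded by the position of the new point, so
gaps carry all the information about `c` over `A`. -/
theorem AgreeOn.insert_of_rk {r r' : F → F → Prop} (hr : StrictLinear r) (hr' : StrictLinear r')
    {A : Finset F} {c : F} (hc : c ∉ A) (h : AgreeOn A r r') (hk : rk r A c = rk r' A c) :
    AgreeOn (insert c A) r r' := by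
  have key : ∀ b ∈ A, (r c b ↔ r' c b) := fun b hb => by
    rw [lt_iff_rk_le hr hc hb, lt_iff_rk_le hr' hc hb, hk, rk_congr h hb]
  have asymm : ∀ {s : F → F → Prop}, StrictLinear s → ∀ b ∈ A, (s b c ↔ ¬ s c b) := by
    intro s hs b hb
    refine ⟨fun h1 h2 => hs.irrefl _ (hs.trans _ _ _ h1 h2), fun h1 => ?_⟩
    exact (hs.total b c (by rintro rfl; exact hc hb)).resolve_right h1
  intro a ha b hb
  rw [Finset.mem_insert] at ha hb
  rcases ha with rfl | ha <;> rcases hb with rfl | hb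
  · simp [hr.irrefl, hr'.irrefl]
  · exact key b hb
  · rw [asymm hr a ha, asymm hr' a ha, key a ha]
  · exact h a ha b hb

end Rank

/-! ### Two-transitivity from two interval cycles -/

/-- The cycle `p → p + 1 → ⋯ → q → p`. -/
def cyc (p q i : ℕ) : ℕ := if i < p then i else if i < q then i + 1 else if i = q then p else i

/-- An equivalence relation on pairs that is invariant under the cycles on `[l, q]` and `[q, h]`
identifies all pairs of distinct elements of `[l, h]`. -/
theorem rel_pair_of_cyc {l q h : ℕ} (hlq : l < q) (hqh : q < h) (E : Setoid (ℕ × ℕ))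
    (h1 : ∀ i j, l ≤ i → i ≤ h → l ≤ j → j ≤ h → E (i, j) (cyc l q i, cyc l q j))
    (h2 : ∀ i j, l ≤ i → i ≤ h → l ≤ j → j ≤ h → E (i, j) (cyc q h i, cyc q h j))
    {i j : ℕ} (hi : l ≤ i) (hih : i ≤ h) (hj : l ≤ j) (hjh : j ≤ h) (hij : i ≠ j) :
    E (i, j) (l, h) := by
  -- The first cycle carries `i` up to `q` and on to `l`, while `j > q` stays fixed.
  have A1 : ∀ n i j, l ≤ i → i < q → q < j → j ≤ h → i + n = q → E (i, j) (l, j) := by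
    intro n
    induction n with
    | zero => intros; omega
    | succ n ih =>
      intro i j hi hiq hj hjh hn
      rcases Nat.eq_zero_or_pos n with rfl | hn0
      · have := h1 i j hi (by omega) (by omega) hjh
        have e1 : cyc l q i = q := by unfold cyc; split_ifs <;> omega
        have e2 : cyc l q j = j := by unfold cyc; split_ifs <;> omega
        rw [e1, e2] at this
        have h3 := h1 q j (by omega) (by omega) (by omega) hjh
        have e3 : cyc l q q = l := by unfold cyc; split_ifs <;> omega
        rw [e3, e2] at h3
        exact E.trans this h3
      · have := h1 i j hi (by omega) (by omega) hjh
        have e1 : cyc l q i = i + 1 := by unfold cyc; split_ifs <;> omega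
        have e2 : cyc l q j = j := by unfold cyc; split_ifs <;> omega
        rw [e1, e2] at this
        exact E.trans this (ih (i + 1) j (by omega) (by omega) hj hjh (by omega))
  -- The second cycle pushes `j` up to `h` and fixes `l`.
  have A2 : ∀ n j, q < j → j + n = h → E (l, j) (l, h) := by
    intro n
    induction n with
    | zero => intro j _ hj; rw [show j = h by omega]
    | succ n ih =>
      intro j hj hn
      have := h2 l j le_rfl (by omega) (by omega) (by omega)
      have e1 : cyc q h l = l := by unfold cyc; split_ifs <;> omega
      have e2 : cyc q h j = j + 1 := by unfold cyc; split_ifs <;> omega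
      rw [e1, e2] at this
      exact E.trans this (ih (j + 1) (by omega) (by omega))
  have B1 : ∀ i j, l ≤ i → i < q → q < j → j ≤ h → E (i, j) (l, h) := fun i j hi hiq hj hjh =>
    E.trans (A1 (q - i) i j hi hiq hj hjh (by omega)) (A2 (h - j) j hj (by omega))
  -- Both entries are at most `q`: the first cycle turns until the second entry is `q`, and the
  -- second cycle then moves that entry past `q`.
  have B2 : ∀ n i j, l ≤ i → i ≤ q → l ≤ j → j + n = q → i ≠ j → E (i, j) (l, h) := by
    intro n
    induction n with
    | zero =>
      intro i j hi hiq hj hn hne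
      have := h2 i j hi (by omega) (by omega) (by omega)
      have e1 : cyc q h i = i := by unfold cyc; split_ifs <;> omega
      have e2 : cyc q h j = j + 1 := by unfold cyc; split_ifs <;> omega
      rw [e1, e2] at this
      exact E.trans this (B1 i (j + 1) hi (by omega) (by omega) (by omega))
    | succ n ih =>
      intro i j hi hiq hj hn hne
      have := h1 i j hi (by omega) (by omega) (by omega)
      have e2 : cyc l q j = j + 1 := by unfold cyc; split_ifs <;> omega
      rw [e2] at this
      refine E.trans this (ih _ (j + 1) ?_ ?_ (by omega) (by omega) ?_) <;> unfold cyc <;>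
        split_ifs <;> omega
  have B3 : ∀ j, q < j → j ≤ h → E (q, j) (l, h) := by
    intro j hj hjh
    have := h1 q j (by omega) (by omega) (by omega) hjh
    have e1 : cyc l q q = l := by unfold cyc; split_ifs <;> omega
    have e2 : cyc l q j = j := by unfold cyc; split_ifs <;> omega
    rw [e1, e2] at this
    exact E.trans this (B1 l j le_rfl hlq hj hjh)
  -- The second cycle turns until the first entry passes from `h` to `q`, which leads to `B2` or
  -- `B3`.
  have B4 : ∀ n i j, q < i → i ≤ h → l ≤ j → j ≤ h → i + n = h → i ≠ j → E (i, j) (l, h) := by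
    intro n
    induction n with
    | zero =>
      intro i j hi hih hj hjh hn hne
      have := h2 i j (by omega) hih hj hjh
      have e1 : cyc q h i = q := by unfold cyc; split_ifs <;> omega
      rw [e1] at this
      refine E.trans this ?_
      rcases lt_or_ge j q with hjq | hjq
      · have e2 : cyc q h j = j := by unfold cyc; split_ifs <;> omega
        rw [e2]
        exact B2 (q - j) q j (by omega) le_rfl hj (by omega) (by omega)
      · refine B3 _ ?_ ?_ <;> unfold cyc <;> split_ifs <;> omega
    | succ n ih =>
      intro i j hi hih hj hjh hn hne
      have := h2 i j (by omega) hih hj hjh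
      have e1 : cyc q h i = i + 1 := by unfold cyc; split_ifs <;> omega
      rw [e1] at this
      rcases lt_or_ge j q with hjq | hjq
      · refine E.trans this (ih (i + 1) _ (by omega) (by omega) ?_ ?_ (by omega) ?_) <;>
          unfold cyc <;> split_ifs <;> omega
      · refine E.trans this (ih (i + 1) _ (by omega) (by omega) ?_ ?_ (by omega) ?_) <;>
          unfold cyc <;> split_ifs <;> omega
  rcases lt_or_ge q i with hqi | hqi
  · exact B4 (h - i) i j hqi hih hj hjh (by omega) hij
  rcases lt_or_ge q j with hqj | hqj
  · rcases hqi.lt_or_eq with hqi | rfl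
    · exact B1 i j hi hqi hqj hjh
    · exact B3 j hqj hjh
  · exact B2 (q - j) i j hi hqi hj (by omega) hij

/-! ### Homogeneous flows of linear orders -/

section Flow

variable {G F M : Type*} [Group G] [MulAction G F] [MulAction G M]

/-- An equivariant assignment of strict linear orders on `F` to the points of `M`. -/
structure IsEquivariantOrder (G : Type*) {F M : Type*} [Group G] [MulAction G F] [MulAction G M]
    (lt : M → F → F → Prop) : Prop where
  linear : ∀ m, StrictLinear (lt m)
  smul : ∀ (g : G) m a b, lt (g • m) (g • a) (g • b) ↔ lt m a b

/-- An equivariant assignment of strict linear orders on `F` to the points of `M` such that any two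
of the orders are isomorphic on each finite set, and finite pieces of them amalgamate. -/
structure IsOrderFlow (G : Type*) {F M : Type*} [Group G] [MulAction G F] [MulAction G M]
    (lt : M → F → F → Prop) : Prop extends IsEquivariantOrder G lt where
  transitive : ∀ (B : Finset F) m m', ∃ g : G, (∀ b, g • b ∈ B ↔ b ∈ B) ∧
    AgreeOn B (lt (g • m)) (lt m')
  amalgamation : ∀ A C : Finset F, A ⊆ C → ∀ c m m', AgreeOn A (lt m) (lt m') →
    ∃ m'' : M, ∃ g : G, AgreeOn C (lt m'') (lt m) ∧ (∀ a ∈ A, g • a = a) ∧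
      AgreeOn (insert c A) (lt (g • m'')) (lt m')

section Equivariant

variable {lt : M → F → F → Prop} (H : IsEquivariantOrder G lt)
include H

theorem IsEquivariantOrder.smul_iff (g : G) (m : M) (a b : F) :
    lt (g • m) a b ↔ lt m (g⁻¹ • a) (g⁻¹ • b) := by
  rw [← H.smul g m, smul_inv_smul, smul_inv_smul]

theorem IsEquivariantOrder.rk_smul (g : G) (m : M) {S S' : Finset F} (h : ∀ b, g • b ∈ S' ↔ b ∈ S)
    (u : F) : rk (lt (g • m)) S' (g • u) = rk (lt m) S u := by
  unfold rk
  symm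
  refine Finset.card_bij (fun b _ => g • b) ?_ ?_ ?_
  · intro a ha
    rw [Finset.mem_filter] at ha ⊢
    exact ⟨(h a).2 ha.1, (H.smul g m a u).2 ha.2⟩
  · intro a _ b _ hab
    exact MulAction.injective g hab
  · intro b hb
    rw [Finset.mem_filter] at hb
    refine ⟨g⁻¹ • b, ?_, smul_inv_smul g b⟩
    rw [Finset.mem_filter, ← h, smul_inv_smul, ← H.smul g, smul_inv_smul]
    exact hb

theorem IsEquivariantOrder.agreeOn_smul (g : G) {m m' : M} {S S' : Finset F}
    (h : ∀ b, g • b ∈ S' ↔ b ∈ S) (hA : AgreeOn S (lt m) (lt m')) :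
    AgreeOn S' (lt (g • m)) (lt (g • m')) := by
  intro a ha b hb
  rw [H.smul_iff, H.smul_iff]
  refine hA _ ?_ _ ?_ <;> rw [← h, smul_inv_smul] <;> assumption

theorem IsEquivariantOrder.rk_of_agreeOn {g : G} {m m' : M} {S : Finset F} (h : ∀ b, g • b ∈ S ↔ b ∈ S)
    (hA : AgreeOn S (lt (g • m)) (lt m')) {b : F} (hb : b ∈ S) :
    rk (lt m') S (g • b) = rk (lt m) S b := by
  rw [← rk_congr hA ((h b).2 hb), H.rk_smul g m h]

/-- Finite linear orders are rigid: an isomorphism preserves ranks, so it fixes each element whose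
rank is the same on both sides. This turns setwise stabilization into pointwise fixing. -/
theorem IsEquivariantOrder.fix_of_rk_eq {g : G} {m m' : M} {S : Finset F} (h : ∀ b, g • b ∈ S ↔ b ∈ S)
    (hA : AgreeOn S (lt (g • m)) (lt m')) {b : F} (hb : b ∈ S)
    (hr : rk (lt m') S b = rk (lt m) S b) : g • b = b :=
  rk_inj (H.linear m') ((h b).2 hb) hb (by rw [H.rk_of_agreeOn h hA hb, hr])

theorem IsEquivariantOrder.fix_of_agreeOn {g : G} {m : M} {S : Finset F}
    (h : ∀ b, g • b ∈ S ↔ b ∈ S) (hA : AgreeOn S (lt (g • m)) (lt m)) {b : F} (hb : b ∈ S) :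
    g • b = b :=
  H.fix_of_rk_eq h hA hb rfl

end Equivariant

variable {lt : M → F → F → Prop} (H : IsOrderFlow G lt)
include H

omit H in
theorem preserves_inv {g : G} {S : Finset F} (h : ∀ b, g • b ∈ S ↔ b ∈ S) (b : F) :
    g⁻¹ • b ∈ S ↔ b ∈ S := by
  rw [← h, smul_inv_smul]

omit H in
theorem preserves_mul {g g' : G} {S : Finset F} (h : ∀ b, g • b ∈ S ↔ b ∈ S)
    (h' : ∀ b, g' • b ∈ S ↔ b ∈ S) (b : F) : (g * g') • b ∈ S ↔ b ∈ S := by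
  rw [mul_smul, h, h']

omit H in
theorem preserves_of_fix {g : G} {S : Finset F} (h : ∀ b ∈ S, g • b = b) (b : F) :
    g • b ∈ S ↔ b ∈ S := by
  refine ⟨fun hb => ?_, fun hb => by rwa [h b hb]⟩
  have := h _ hb
  rwa [← MulAction.injective g this]

omit H in
theorem preserves_erase {g : G} {A : Finset F} {c : F} (hc : c ∉ A)
    (h : ∀ b, g • b ∈ insert c A ↔ b ∈ insert c A) (hgc : g • c = c) (b : F) :
    g • b ∈ A ↔ b ∈ A := by
  have h1 := h b
  rw [Finset.mem_insert, Finset.mem_insert] at h1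
  by_cases hb : b = c
  · subst hb; simp [hgc]
  · have : g • b ≠ c := fun h' => hb (MulAction.injective g (h'.trans hgc.symm))
    tauto

/-- `p` is the rank of `c` over `A` in some order that agrees with that of `m₀` on `A`. -/
def IsGap (lt : M → F → F → Prop) (A : Finset F) (c : F) (m₀ : M) (p : ℕ) : Prop :=
  ∃ m, AgreeOn A (lt m) (lt m₀) ∧ rk (lt m) A c = p

/-- The elements of `insert c A` whose rank lies outside `[l, h]`. -/
def Outer (lt : M → F → F → Prop) (A : Finset F) (c : F) (m₀ : M) (l h : ℕ) (r : F) : Prop :=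
  r ∈ insert c A ∧ (rk (lt m₀) (insert c A) r < l ∨ h < rk (lt m₀) (insert c A) r)

/-- The elements of `insert c A` whose rank lies in `[l, h]`. -/
def inner (lt : M → F → F → Prop) (A : Finset F) (c : F) (m₀ : M) (l h : ℕ) : Finset F :=
  (insert c A).filter fun u =>
    l ≤ rk (lt m₀) (insert c A) u ∧ rk (lt m₀) (insert c A) u ≤ h

/-- Take two orders that agree on `A` and put `c` at positions `p` and `q`. Moving `c` from `q` down
to `p` raises the elements in between by one rank, so the ranks change by `cyc p q`. Transitivity
identifies both orders with that of `m₀`. -/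
theorem IsOrderFlow.exists_smul_cyc {A : Finset F} {c : F} (hc : c ∉ A) {m₀ : M} {p q : ℕ}
    (hp : IsGap lt A c m₀ p) (hq : IsGap lt A c m₀ q) (hpq : p < q) :
    ∃ g : G, (∀ b, g • b ∈ insert c A ↔ b ∈ insert c A) ∧ ∀ b ∈ insert c A,
      rk (lt m₀) (insert c A) (g • b) = cyc p q (rk (lt m₀) (insert c A) b) := by
  obtain ⟨mp, hmp, hp⟩ := hp
  obtain ⟨mq, hmq, hq⟩ := hq
  obtain ⟨s, hs, hsA⟩ := H.transitive (insert c A) m₀ mp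
  obtain ⟨t, ht, htA⟩ := H.transitive (insert c A) m₀ mq
  refine ⟨s⁻¹ * t, preserves_mul (preserves_inv hs) ht, fun b hb => ?_⟩
  have h1 : ∀ b ∈ insert c A, rk (lt mp) (insert c A) b =
      cyc p q (rk (lt mq) (insert c A) b) := by
    intro b hb
    rcases Finset.mem_insert.1 hb with rfl | hbA
    · rw [rk_insert_self (H.linear _) hc, rk_insert_self (H.linear _) hc, hp, hq]
      unfold cyc; split_ifs <;> omega
    · rw [rk_insert _ hc, rk_insert _ hc, lt_iff_rk_le (H.linear _) hc hbA,
        lt_iff_rk_le (H.linear _) hc hbA, hp, hq, rk_congr hmp hbA, rk_congr hmq hbA]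
      unfold cyc; split_ifs <;> omega
  have h2 : (s⁻¹ * t) • b ∈ insert c A := (preserves_mul (preserves_inv hs) ht b).2 hb
  rw [← H.rk_of_agreeOn hs hsA h2, mul_smul, smul_inv_smul, h1 _ ((ht b).2 hb),
    H.rk_of_agreeOn ht htA hb]

/-- If `c` has at least three gaps over `A`, the automorphisms of `insert c A` that fix the elements
outside of the block spanned by the gaps are two-transitive on the block. -/
theorem IsOrderFlow.exists_smul_pair {A : Finset F} {c : F} (hc : c ∉ A) {m₀ : M} {l q h : ℕ}
    (hl : IsGap lt A c m₀ l) (hq : IsGap lt A c m₀ q) (hh : IsGap lt A c m₀ h) (hlq : l < q)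
    (hqh : q < h) {u v u' v' : F} (hu : u ∈ inner lt A c m₀ l h) (hv : v ∈ inner lt A c m₀ l h)
    (huv : u ≠ v) (hu' : u' ∈ inner lt A c m₀ l h) (hv' : v' ∈ inner lt A c m₀ l h)
    (huv' : u' ≠ v') :
    ∃ g : G, (∀ b, g • b ∈ insert c A ↔ b ∈ insert c A) ∧
      (∀ r, Outer lt A c m₀ l h r → g • r = r) ∧ g • u = u' ∧ g • v = v' := by
  set B := insert c A with hB
  set ρ : F → ℕ := rk (lt m₀) B with hρ
  let Good : G → Prop := fun g => (∀ b, g • b ∈ B ↔ b ∈ B) ∧ ∀ r, Outer lt A c m₀ l h r → g • r = r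
  -- Two pairs of ranks are related if some admissible group element carries the elements of the
  -- first ranks to those of the second.
  let E : Setoid (ℕ × ℕ) :=
    { r := fun x y => ∃ g : G, Good g ∧ ∀ b ∈ B, (ρ b = x.1 ↔ ρ (g • b) = y.1) ∧
        (ρ b = x.2 ↔ ρ (g • b) = y.2)
      iseqv := by
        refine ⟨fun x => ⟨1, ⟨fun b => by simp, fun r _ => by simp⟩, fun b _ => by simp⟩, ?_, ?_⟩
        · rintro x y ⟨g, ⟨hg, hgR⟩, hgE⟩
          refine ⟨g⁻¹, ⟨preserves_inv hg, fun r hr => inv_smul_eq_iff.2 (hgR r hr).symm⟩,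
            fun b hb => ?_⟩
          have := hgE (g⁻¹ • b) ((preserves_inv hg b).2 hb)
          rw [smul_inv_smul] at this
          exact ⟨this.1.symm, this.2.symm⟩
        · rintro x y z ⟨g, ⟨hg, hgR⟩, hgE⟩ ⟨k, ⟨hk, hkR⟩, hkE⟩
          refine ⟨k * g, ⟨preserves_mul hk hg, fun r hr => by rw [mul_smul, hgR r hr, hkR r hr]⟩,
            fun b hb => ?_⟩
          have h1 := hgE b hb
          have h2 := hkE (g • b) ((hg b).2 hb)
          rw [mul_smul]
          exact ⟨h1.1.trans h2.1, h1.2.trans h2.2⟩ }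
  have hcyc : ∀ p p', IsGap lt A c m₀ p → IsGap lt A c m₀ p' → l ≤ p → p < p' → p' ≤ h →
      ∀ i j, E (i, j) (cyc p p' i, cyc p p' j) := by
    intro p p' hp hp' hlp hpp' hph i j
    obtain ⟨g, hg, hgc⟩ := H.exists_smul_cyc hc hp hp' hpp'
    have inj : ∀ a b, cyc p p' a = cyc p p' b → a = b := by
      intro a b hab
      unfold cyc at hab
      split_ifs at hab <;> omega
    refine ⟨g, ⟨hg, fun r hr => ?_⟩, fun b hb => ?_⟩
    · refine rk_inj (H.linear m₀) ((hg r).2 hr.1) hr.1 ?_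
      rw [hgc r hr.1]
      have := hr.2
      unfold cyc; split_ifs <;> omega
    · have := hgc b hb
      change ρ (g • b) = cyc p p' (ρ b) at this
      rw [this]
      exact ⟨⟨fun h => by rw [h], inj _ _⟩, ⟨fun h => by rw [h], inj _ _⟩⟩
  have main : ∀ u v, u ∈ inner lt A c m₀ l h → v ∈ inner lt A c m₀ l h → u ≠ v →
      E (ρ u, ρ v) (l, h) := by
    intro u v hu hv huv
    obtain ⟨huB, hu1, hu2⟩ := Finset.mem_filter.1 hu
    obtain ⟨hvB, hv1, hv2⟩ := Finset.mem_filter.1 hv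
    exact rel_pair_of_cyc hlq hqh E
      (fun i j _ _ _ _ => hcyc l q hl hq le_rfl hlq hqh.le i j)
      (fun i j _ _ _ _ => hcyc q h hq hh hlq.le hqh le_rfl i j) hu1 hu2 hv1 hv2
      fun h' => huv (rk_inj (H.linear m₀) huB hvB h')
  obtain ⟨g, ⟨hg, hgR⟩, hgE⟩ := E.trans (main u v hu hv huv) (E.symm (main u' v' hu' hv' huv'))
  have huB := (Finset.mem_filter.1 hu).1
  have hvB := (Finset.mem_filter.1 hv).1
  refine ⟨g, hg, hgR, ?_, ?_⟩
  · exact rk_inj (H.linear m₀) ((hg u).2 huB) (Finset.mem_filter.1 hu').1 ((hgE u huB).1.1 rfl)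
  · exact rk_inj (H.linear m₀) ((hg v).2 hvB) (Finset.mem_filter.1 hv').1 ((hgE v hvB).2.1 rfl)

end Flow

/-! ### Invariant measures on homogeneous flows of linear orders -/

section Measure

variable {G F M : Type*} [Group G] [MulAction G F] [MulAction G M]

/-- The restriction of a relation to a finite set. -/
def restr (B : Finset F) (r : F → F → Prop) : B → B → Prop := fun a b => r a b

theorem restr_eq_iff {B : Finset F} {r r' : F → F → Prop} :
    restr B r = restr B r' ↔ AgreeOn B r r' := by
  refine ⟨fun h a ha b hb => ?_, fun h => ?_⟩
  · exact iff_of_eq (congrFun (congrFun h ⟨a, ha⟩) ⟨b, hb⟩)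
  · funext a b
    exact propext (h a a.2 b b.2)

/-- There are finitely many relations on `B`, so a set that depends only on the order on `B` is a
finite union of cylinders. -/
theorem measurableSet_of_agreeOn [MeasurableSpace M] {lt : M → F → F → Prop}
    (hmeas : ∀ a b, MeasurableSet {m | lt m a b}) (B : Finset F) (s : Set M)
    (hs : ∀ m m', AgreeOn B (lt m) (lt m') → m ∈ s → m' ∈ s) : MeasurableSet s := by
  have h1 : ∀ m, MeasurableSet {m' | AgreeOn B (lt m') (lt m)} := by
    intro m
    have : {m' | AgreeOn B (lt m') (lt m)} =
        ⋂ a ∈ B, ⋂ b ∈ B, {m' | lt m' a b ↔ lt m a b} := by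
      ext m'; simp [AgreeOn]
    rw [this]
    refine Finset.measurableSet_biInter _ fun a _ => Finset.measurableSet_biInter _ fun b _ => ?_
    by_cases h : lt m a b
    · simpa [h] using hmeas a b
    · simp only [h, iff_false]
      exact (hmeas a b).compl
  have h2 : s = ⋃ x ∈ (fun m => restr B (lt m)) '' s, (fun m => restr B (lt m)) ⁻¹' {x} := by
    ext m
    simp only [Set.mem_iUnion, Set.mem_preimage, Set.mem_singleton_iff, exists_prop,
      exists_eq_right']
    refine ⟨fun h => ⟨m, h, rfl⟩, ?_⟩
    rintro ⟨m', hm', h⟩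
    exact hs m' m (restr_eq_iff.1 h) hm'
  rw [h2]
  refine MeasurableSet.biUnion (Set.to_countable _) ?_
  rintro _ ⟨m, _, rfl⟩
  convert h1 m using 1
  ext m'
  exact restr_eq_iff

/-- By induction, a new event adds `a` minus its overlap with the earlier union, which is at most
`s.card * b`. The square is a crude bound for the number of pairs. -/
theorem bonferroni [MeasurableSpace M] (μ : Measure M) [IsProbabilityMeasure μ] {ι : Type*}
    (s : Finset ι) (E : ι → Set M) (hE : ∀ i, MeasurableSet (E i)) (a b : ℝ) (hb0 : 0 ≤ b)
    (ha : ∀ i ∈ s, μ.real (E i) = a)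
    (hb : ∀ i ∈ s, ∀ j ∈ s, i ≠ j → μ.real (E i ∩ E j) ≤ b) :
    s.card * a - s.card ^ 2 * b ≤ μ.real (⋃ i ∈ s, E i) := by
  induction s using Finset.induction_on with
  | empty => simp
  | insert i s hi ih =>
    have ih := ih (fun j hj => ha j (Finset.mem_insert_of_mem hj)) fun j hj k hk =>
      hb j (Finset.mem_insert_of_mem hj) k (Finset.mem_insert_of_mem hk)
    rw [Finset.set_biUnion_insert, Finset.card_insert_of_notMem hi]
    have hm : MeasurableSet (⋃ j ∈ s, E j) := Finset.measurableSet_biUnion _ fun j _ => hE j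
    have h1 := measureReal_union_add_inter (μ := μ) (s := E i) hm (measure_ne_top _ _)
      (measure_ne_top _ _)
    have h2 : μ.real (E i ∩ ⋃ j ∈ s, E j) ≤ s.card * b := by
      rw [Set.inter_iUnion₂]
      refine (measureReal_biUnion_finset_le s _).trans ?_
      rw [← nsmul_eq_mul]
      refine Finset.sum_le_card_nsmul _ _ _ fun j hj => ?_
      exact hb i (Finset.mem_insert_self _ _) j (Finset.mem_insert_of_mem hj)
        (by rintro rfl; exact hi hj)
    have h3 := ha i (Finset.mem_insert_self _ _)
    have h4 : (0 : ℝ) ≤ s.card := Nat.cast_nonneg _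
    push_cast
    nlinarith

theorem measureReal_eq_of_smul [MeasurableSpace M] (μ : Measure M) [SMulInvariantMeasure G M μ]
    {s t : Set M} (ht : MeasurableSet t) (g : G) (h : ∀ m, m ∈ s ↔ g • m ∈ t) :
    μ.real s = μ.real t := by
  have : s = (fun m => g • m) ⁻¹' t := Set.ext h
  unfold Measure.real
  rw [this, SMulInvariantMeasure.measure_preimage_smul g ht]

theorem measureReal_eq_sum_restr [MeasurableSpace M] (μ : Measure M) [IsProbabilityMeasure μ]
    {lt : M → F → F → Prop} (hmeas : ∀ a b, MeasurableSet {m | lt m a b}) (B : Finset F)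
    {s : Set M} (hs : MeasurableSet s) :
    μ.real s = ∑ x : B → B → Prop, μ.real (s ∩ {m | restr B (lt m) = x}) := by
  rw [← measureReal_biUnion_finset]
  · congr 1
    ext m
    simp
  · intro x _ y _ hxy
    refine Set.disjoint_left.2 ?_
    rintro m ⟨_, hx⟩ ⟨_, hy⟩
    exact hxy (hx.symm.trans hy)
  · intro x _
    refine hs.inter (measurableSet_of_agreeOn hmeas B _ fun m m' h hm => ?_)
    exact (restr_eq_iff.2 h).symm.trans hm

variable {lt : M → F → F → Prop} (H : IsOrderFlow G lt)

section
include H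

/-- The group element given by transitivity carries one cylinder exactly onto the other. This
rigidity of masses is the source of unique ergodicity. -/
theorem IsOrderFlow.measureReal_agreeOn_eq [MeasurableSpace M] (μ : Measure M)
    [SMulInvariantMeasure G M μ] (hmeas : ∀ a b, MeasurableSet {m | lt m a b}) (B : Finset F)
    (m₁ m₂ : M) :
    μ.real {m | AgreeOn B (lt m) (lt m₁)} = μ.real {m | AgreeOn B (lt m) (lt m₂)} := by
  obtain ⟨g, hg, hgA⟩ := H.transitive B m₁ m₂
  refine measureReal_eq_of_smul μ (measurableSet_of_agreeOn hmeas B _ fun m m' h hm =>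
    h.symm.trans hm) g fun m => ⟨fun h => (H.agreeOn_smul g hg h).trans hgA, fun h => ?_⟩
  have := H.agreeOn_smul g⁻¹ (preserves_inv hg) (AgreeOn.trans h hgA.symm)
  rwa [inv_smul_smul, inv_smul_smul] at this

theorem IsOrderFlow.measureReal_agreeOn_pos [MeasurableSpace M] (μ : Measure M)
    [IsProbabilityMeasure μ] [SMulInvariantMeasure G M μ]
    (hmeas : ∀ a b, MeasurableSet {m | lt m a b}) (B : Finset F) (m₀ : M) :
    0 < μ.real {m | AgreeOn B (lt m) (lt m₀)} := by
  by_contra hcon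
  have h0 := le_antisymm (not_lt.1 hcon) measureReal_nonneg
  have h1 := measureReal_eq_sum_restr μ hmeas B (s := Set.univ) MeasurableSet.univ
  rw [Finset.sum_eq_zero] at h1
  · simp at h1
  · intro x _
    by_cases hx : ∃ m, restr B (lt m) = x
    · obtain ⟨m, rfl⟩ := hx
      rw [Set.univ_inter, ← h0, H.measureReal_agreeOn_eq μ hmeas B m₀ m]
      simp_rw [restr_eq_iff]
    · have : {m | restr B (lt m) = x} = ∅ := by
        ext m; simpa using fun h => hx ⟨m, h⟩
      simp [this]

end

/-! #### The events attached to a block of gaps -/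

/-- The elements outside the block have the same rank in `insert c A` as they have at `m₀`. -/
def outerEvent (lt : M → F → F → Prop) (A : Finset F) (c : F) (m₀ : M) (l h : ℕ) : Set M :=
  {m | ∀ r, Outer lt A c m₀ l h r → rk (lt m) (insert c A) r = rk (lt m₀) (insert c A) r}

/-- The element `c'` lies over `A` as `c` does at `m₀`, up to a permutation of the block. -/
def gapEvent (lt : M → F → F → Prop) (A : Finset F) (c : F) (m₀ : M) (l h : ℕ) (c' : F) : Set M :=
  {m | rk (lt m) A c' = rk (lt m₀) A c ∧
    ∀ r, Outer lt A c m₀ l h r → rk (lt m) (insert c' A) r = rk (lt m₀) (insert c A) r}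

theorem rk_congr_of_subset {r r' : F → F → Prop} {S C : Finset F} (h : AgreeOn C r r')
    (hS : S ⊆ C) {u : F} (hu : u ∈ C) : rk r S u = rk r' S u := by
  unfold rk
  congr 1
  exact Finset.filter_congr fun a ha => h a (hS ha) u hu

theorem measurableSet_outerEvent [MeasurableSpace M] (hmeas : ∀ a b, MeasurableSet {m | lt m a b})
    (A : Finset F) (c : F) (m₀ : M) (l h : ℕ) : MeasurableSet (outerEvent lt A c m₀ l h) :=
  measurableSet_of_agreeOn hmeas (insert c A) _ fun m m' hmm hm r hr => by
    rw [← rk_congr hmm hr.1, hm r hr]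

theorem measurableSet_rk_eq [MeasurableSpace M] (hmeas : ∀ a b, MeasurableSet {m | lt m a b})
    (S : Finset F) (u : F) (i : ℕ) : MeasurableSet {m | rk (lt m) S u = i} :=
  measurableSet_of_agreeOn hmeas (insert u S) _ fun m m' hmm hm => by
    rw [Set.mem_ofPred_eq, ← rk_congr_of_subset hmm (Finset.subset_insert _ _)
      (Finset.mem_insert_self _ _)]
    exact hm

theorem measurableSet_gapEvent [MeasurableSpace M] (hmeas : ∀ a b, MeasurableSet {m | lt m a b})
    (A : Finset F) (c : F) (m₀ : M) (l h : ℕ) (c' : F) :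
    MeasurableSet (gapEvent lt A c m₀ l h c') :=
  measurableSet_of_agreeOn hmeas (insert c' (insert c A)) _ fun m m' hmm hm => by
    refine ⟨?_, fun r hr => ?_⟩
    · rw [← rk_congr_of_subset hmm _ (Finset.mem_insert_self _ _), hm.1]
      intro x hx; simp [hx]
    · rw [← rk_congr_of_subset hmm _ (Finset.mem_insert_of_mem hr.1), hm.2 r hr]
      intro x hx
      simp only [Finset.mem_insert] at hx ⊢
      tauto

section
include H

theorem IsOrderFlow.smul_mem_outerEvent_iff {A : Finset F} {c : F} {m₀ : M} {l h : ℕ} {g : G}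
    (hg : ∀ b, g • b ∈ insert c A ↔ b ∈ insert c A)
    (hgR : ∀ r, Outer lt A c m₀ l h r → g • r = r) (m : M) :
    m ∈ outerEvent lt A c m₀ l h ↔ g • m ∈ outerEvent lt A c m₀ l h := by
  refine forall₂_congr fun r hr => ?_
  conv_rhs => rw [← hgR r hr, H.rk_smul g m hg, hgR r hr]

theorem IsOrderFlow.smul_mem_gapEvent_iff {A : Finset F} {c : F} {m₀ : M} {l h : ℕ} {g : G}
    (hg : ∀ b, g • b ∈ A ↔ b ∈ A) (hgR : ∀ r, Outer lt A c m₀ l h r → g • r = r) (m : M) (c' : F) :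
    m ∈ gapEvent lt A c m₀ l h c' ↔ g • m ∈ gapEvent lt A c m₀ l h (g • c') := by
  refine and_congr ?_ (forall₂_congr fun r hr => ?_)
  · rw [H.rk_smul g m hg]
  · have : ∀ b, g • b ∈ insert (g • c') A ↔ b ∈ insert c' A := by
      intro b
      rw [Finset.mem_insert, Finset.mem_insert, hg, (MulAction.injective g).eq_iff]
    conv_rhs => rw [← hgR r hr, H.rk_smul g m this, hgR r hr]

end

end Measure

/-! ### Second moments of ranks in a block of gaps -/

section Block

variable {G F M : Type*} [Group G] [MulAction G F] [MulAction G M] {lt : M → F → F → Prop}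

/-- The gaps of `c` over `A` span the interval `[l, h]`, and there is a gap `q` strictly between. -/
structure IsBlock (lt : M → F → F → Prop) (A : Finset F) (c : F) (m₀ : M) (l q h : ℕ) : Prop where
  notMem : c ∉ A
  gap_left : IsGap lt A c m₀ l
  gap_mid : IsGap lt A c m₀ q
  gap_right : IsGap lt A c m₀ h
  left_lt : l < q
  lt_right : q < h
  bound : ∀ p, IsGap lt A c m₀ p → l ≤ p ∧ p ≤ h

variable (H : IsOrderFlow G lt) {A : Finset F} {c : F} {m₀ : M} {l q h : ℕ}
  (hB : IsBlock lt A c m₀ l q h)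
include H hB

theorem IsBlock.not_outer : ¬ Outer lt A c m₀ l h c := by
  rintro ⟨_, hr⟩
  rw [rk_insert_self (H.linear _) hB.notMem] at hr
  have := hB.bound _ ⟨m₀, AgreeOn.refl _ _, rfl⟩
  omega

theorem IsBlock.mem_of_outer {r : F} (hr : Outer lt A c m₀ l h r) : r ∈ A := by
  refine (Finset.mem_insert.1 hr.1).resolve_left ?_
  rintro rfl
  exact hB.not_outer H hr

theorem IsBlock.mem_inner : c ∈ inner lt A c m₀ l h := by
  refine Finset.mem_filter.2 ⟨Finset.mem_insert_self _ _, ?_⟩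
  rw [rk_insert_self (H.linear _) hB.notMem]
  exact hB.bound _ ⟨m₀, AgreeOn.refl _ _, rfl⟩

omit H hB in
theorem mem_inner_of_not_outer {u : F} (hu : u ∈ insert c A) (h' : ¬ Outer lt A c m₀ l h u) :
    u ∈ inner lt A c m₀ l h := by
  refine Finset.mem_filter.2 ⟨hu, ?_⟩
  by_contra hcon
  exact h' ⟨hu, by omega⟩

theorem IsBlock.gapEvent_self :
    gapEvent lt A c m₀ l h c =
      outerEvent lt A c m₀ l h ∩ {m | rk (lt m) (insert c A) c = rk (lt m₀) A c} := by
  ext m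
  simp only [gapEvent, outerEvent, Set.mem_ofPred_eq, Set.mem_inter_iff,
    rk_insert_self (H.linear m) hB.notMem]
  exact and_comm

theorem IsBlock.lt_iff_of_mem_gapEvent {m : M} {c' : F} (hc' : c' ∉ A)
    (hm : m ∈ gapEvent lt A c m₀ l h c') {r : F} (hr : Outer lt A c m₀ l h r) :
    lt m c' r ↔ h < rk (lt m₀) (insert c A) r := by
  have hrA := hB.mem_of_outer H hr
  have h1 := hm.2 r hr
  have h2 := hr.2
  have hj := hB.bound _ ⟨m₀, AgreeOn.refl _ _, rfl⟩
  rw [rk_insert _ hc', lt_iff_rk_le (H.linear m) hc' hrA, hm.1] at h1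
  rw [lt_iff_rk_le (H.linear m) hc' hrA, hm.1]
  split_ifs at h1 <;> omega

section

variable [MeasurableSpace M] (μ : Measure M) [IsProbabilityMeasure μ] [SMulInvariantMeasure G M μ]
  (hmeas : ∀ a b, MeasurableSet {m | lt m a b})
include hmeas

/-- On the outer event the rank that `c` has at `m₀` is occupied by some element of the block, and
by transitivity on the block each of them occupies it with the same probability. -/
theorem IsBlock.measureReal_outerEvent_le :
    μ.real (outerEvent lt A c m₀ l h) ≤
      (inner lt A c m₀ l h).card * μ.real (gapEvent lt A c m₀ l h c) := by
  let j := rk (lt m₀) A c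
  let W : F → Set M := fun e => outerEvent lt A c m₀ l h ∩ {m | rk (lt m) (insert c A) e = j}
  have hW : ∀ e, MeasurableSet (W e) := fun e =>
    (measurableSet_outerEvent hmeas A c m₀ l h).inter (measurableSet_rk_eq hmeas _ _ _)
  have h1 : outerEvent lt A c m₀ l h ⊆ ⋃ e ∈ inner lt A c m₀ l h, W e := by
    intro m hm
    obtain ⟨g, hg, hgA⟩ := H.transitive (insert c A) m₀ m
    have hgR : ∀ r, Outer lt A c m₀ l h r → g • r = r := fun r hr =>
      H.fix_of_rk_eq hg hgA hr.1 (hm r hr)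
    have hgc : g • c ∈ insert c A := (hg c).2 (Finset.mem_insert_self _ _)
    refine Set.mem_iUnion₂.2 ⟨g • c, mem_inner_of_not_outer hgc fun ho => ?_, hm, ?_⟩
    · have : g • c = c := MulAction.injective g (hgR _ ho)
      rw [this] at ho
      exact hB.not_outer H ho
    · rw [Set.mem_ofPred_eq, H.rk_of_agreeOn hg hgA (Finset.mem_insert_self _ _),
        rk_insert_self (H.linear _) hB.notMem]
  have h2 : ∀ e ∈ inner lt A c m₀ l h, μ.real (W e) = μ.real (gapEvent lt A c m₀ l h c) := by
    intro e he
    rw [hB.gapEvent_self H]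
    change _ = μ.real (W c)
    by_cases hec : e = c
    · rw [hec]
    obtain ⟨g, hg, hgR, hge, -⟩ := H.exists_smul_pair hB.notMem hB.gap_left hB.gap_mid
      hB.gap_right hB.left_lt hB.lt_right he (hB.mem_inner H) hec (hB.mem_inner H) he (Ne.symm hec)
    refine measureReal_eq_of_smul μ (hW c) g fun m =>
      and_congr (H.smul_mem_outerEvent_iff hg hgR m) ?_
    have h3 := H.rk_smul g m hg e
    rw [hge] at h3
    rw [Set.mem_ofPred_eq, Set.mem_ofPred_eq, h3]
  calc μ.real (outerEvent lt A c m₀ l h) ≤ μ.real (⋃ e ∈ inner lt A c m₀ l h, W e) :=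
        measureReal_mono h1 (measure_ne_top _ _)
    _ ≤ ∑ e ∈ inner lt A c m₀ l h, μ.real (W e) := measureReal_biUnion_finset_le _ _
    _ = _ := by rw [Finset.sum_congr rfl h2, Finset.sum_const, nsmul_eq_mul]

/-- By two-transitivity the ordered pairs of distinct block elements are equally likely to occupy
the ranks `i` and `j`. These events are disjoint parts of the outer event. -/
theorem IsBlock.measureReal_pair_le {u v : F} (hu : u ∈ inner lt A c m₀ l h)
    (hv : v ∈ inner lt A c m₀ l h) (huv : u ≠ v) (i j : ℕ) :
    ((inner lt A c m₀ l h).card * ((inner lt A c m₀ l h).card - 1 : ℝ)) *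
      μ.real (outerEvent lt A c m₀ l h ∩ {m | rk (lt m) (insert c A) u = i} ∩
        {m | rk (lt m) (insert c A) v = j}) ≤ μ.real (outerEvent lt A c m₀ l h) := by
  let W : F × F → Set M := fun e => outerEvent lt A c m₀ l h ∩
    {m | rk (lt m) (insert c A) e.1 = i} ∩ {m | rk (lt m) (insert c A) e.2 = j}
  have hW : ∀ e, MeasurableSet (W e) := fun e =>
    ((measurableSet_outerEvent hmeas A c m₀ l h).inter (measurableSet_rk_eq hmeas _ _ _)).inter
      (measurableSet_rk_eq hmeas _ _ _)
  have h2 : ∀ e ∈ (inner lt A c m₀ l h).offDiag, μ.real (W e) = μ.real (W (u, v)) := by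
    rintro ⟨a, b⟩ he
    obtain ⟨ha, hb, hab⟩ := Finset.mem_offDiag.1 he
    obtain ⟨g, hg, hgR, hgu, hgv⟩ := H.exists_smul_pair hB.notMem hB.gap_left hB.gap_mid
      hB.gap_right hB.left_lt hB.lt_right ha hb hab hu hv huv
    refine measureReal_eq_of_smul μ (hW _) g fun m =>
      and_congr (and_congr (H.smul_mem_outerEvent_iff hg hgR m) ?_) ?_
    · simp only [Set.mem_ofPred_eq]
      rw [← hgu, H.rk_smul g m hg]
    · simp only [Set.mem_ofPred_eq]
      rw [← hgv, H.rk_smul g m hg]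
  have h3 : μ.real (⋃ e ∈ (inner lt A c m₀ l h).offDiag, W e) =
      ∑ e ∈ (inner lt A c m₀ l h).offDiag, μ.real (W e) := by
    refine measureReal_biUnion_finset ?_ fun e _ => hW e
    rintro ⟨a, b⟩ he ⟨a', b'⟩ he' hne
    obtain ⟨ha, hb, -⟩ := Finset.mem_offDiag.1 (Finset.mem_coe.1 he)
    obtain ⟨ha', hb', -⟩ := Finset.mem_offDiag.1 (Finset.mem_coe.1 he')
    refine Set.disjoint_left.2 ?_
    rintro m ⟨⟨_, h1⟩, h2⟩ ⟨⟨_, h3⟩, h4⟩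
    refine hne (Prod.ext ?_ ?_)
    · exact rk_inj (H.linear m) (Finset.mem_filter.1 ha).1 (Finset.mem_filter.1 ha').1
        (h1.trans h3.symm)
    · exact rk_inj (H.linear m) (Finset.mem_filter.1 hb).1 (Finset.mem_filter.1 hb').1
        (h2.trans h4.symm)
  have hcard : ((inner lt A c m₀ l h).offDiag.card : ℝ) =
      (inner lt A c m₀ l h).card * ((inner lt A c m₀ l h).card - 1 : ℝ) := by
    rw [Finset.offDiag_card, Nat.cast_sub (Nat.le_mul_self _)]
    push_cast
    ring
  rw [Finset.sum_congr rfl h2, Finset.sum_const, nsmul_eq_mul, hcard] at h3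
  rw [← h3]
  refine measureReal_mono (Set.iUnion₂_subset fun e _ m hm => hm.1.1)

end

/-- The elements of ranks `j` and `j + 1` over `insert c A` after adding `c'` to the block. -/
def pairEvent (lt : M → F → F → Prop) (A : Finset F) (c : F) (m₀ : M) (l h : ℕ) (c' u v : F) :
    Set M :=
  {m | (∀ r, Outer lt A c m₀ l h r → rk (lt m) (insert c' (insert c A)) r =
      rk (lt m₀) (insert c A) r + if h < rk (lt m₀) (insert c A) r then 1 else 0) ∧
    rk (lt m) (insert c' (insert c A)) u = rk (lt m₀) A c ∧
    rk (lt m) (insert c' (insert c A)) v = rk (lt m₀) A c + 1}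

omit H hB in
theorem measurableSet_pairEvent [MeasurableSpace M] (hmeas : ∀ a b, MeasurableSet {m | lt m a b})
    (A : Finset F) (c : F) (m₀ : M) (l h : ℕ) {c' u v : F}
    (hu : u ∈ insert c' (insert c A)) (hv : v ∈ insert c' (insert c A)) :
    MeasurableSet (pairEvent lt A c m₀ l h c' u v) :=
  measurableSet_of_agreeOn hmeas (insert c' (insert c A)) _ fun m m' hmm hm => by
    refine ⟨fun r hr => ?_, ?_, ?_⟩
    · rw [← rk_congr hmm (Finset.mem_insert_of_mem hr.1), hm.1 r hr]
    · rw [← rk_congr hmm hu, hm.2.1]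
    · rw [← rk_congr hmm hv, hm.2.2]

/-- Both `c` and `c'` sit at the same position over `A`, so they are adjacent once both are added,
and the lower one keeps the rank of that position. -/
theorem IsBlock.mem_pairEvent {c' : F} (hc' : c' ∉ insert c A) {m : M}
    (hm : m ∈ gapEvent lt A c m₀ l h c) (hm' : m ∈ gapEvent lt A c m₀ l h c') :
    (lt m c c' → m ∈ pairEvent lt A c m₀ l h c' c c') ∧
      (lt m c' c → m ∈ pairEvent lt A c m₀ l h c' c' c) := by
  have hc'A : c' ∉ A := fun h' => hc' (Finset.mem_insert_of_mem h')
  have h1 : ∀ r, Outer lt A c m₀ l h r → rk (lt m) (insert c' (insert c A)) r =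
      rk (lt m₀) (insert c A) r + if h < rk (lt m₀) (insert c A) r then 1 else 0 := by
    intro r hr
    rw [rk_insert _ hc', hm.2 r hr, hB.lt_iff_of_mem_gapEvent H hc'A hm' hr]
    split_ifs <;> rfl
  have h2 : rk (lt m) (insert c' (insert c A)) c = rk (lt m₀) A c + if lt m c' c then 1 else 0 := by
    rw [rk_insert _ hc', rk_insert_self (H.linear m) hB.notMem, hm.1]
  have h3 : rk (lt m) (insert c' (insert c A)) c' =
      rk (lt m₀) A c + if lt m c c' then 1 else 0 := by
    rw [rk_insert_self (H.linear m) hc', rk_insert _ hB.notMem, hm'.1]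
  have asymm : ∀ {a b}, lt m a b → ¬ lt m b a := fun h1 h2 =>
    (H.linear m).irrefl _ ((H.linear m).trans _ _ _ h1 h2)
  refine ⟨fun hlt => ⟨h1, ?_, ?_⟩, fun hlt => ⟨h1, ?_, ?_⟩⟩
  · rw [h2, if_neg (asymm hlt), add_zero]
  · rw [h3, if_pos hlt]
  · rw [h3, if_neg (asymm hlt), add_zero]
  · rw [h2, if_pos hlt]

/-- The outer elements already occupy every rank below `l` and every rank above `h + 1`. -/
theorem IsBlock.rk_le_of_mem_outer {c' : F} (hc' : c' ∉ insert c A) {m : M}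
    (hm : ∀ r, Outer lt A c m₀ l h r → rk (lt m) (insert c' (insert c A)) r =
      rk (lt m₀) (insert c A) r + if h < rk (lt m₀) (insert c A) r then 1 else 0) :
    l ≤ rk (lt m) (insert c' (insert c A)) c' ∧ rk (lt m) (insert c' (insert c A)) c' ≤ h + 1 := by
  have hcard : rk (lt m) (insert c' (insert c A)) c' < (insert c A).card + 1 := by
    rw [← Finset.card_insert_of_notMem hc']
    exact rk_lt_card (H.linear m) (Finset.mem_insert_self _ _)
  have hlow : l ≤ (insert c A).card := by
    have h1 := (hB.bound _ ⟨m₀, AgreeOn.refl _ _, rfl⟩).1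
    have h2 := rk_lt_card (H.linear m₀) (Finset.mem_insert_self c A)
    rw [rk_insert_self (H.linear m₀) hB.notMem] at h2
    omega
  constructor
  · by_contra hcon
    obtain ⟨r, hrB, hr⟩ := exists_rk_eq (H.linear m₀) (insert c A)
      (i := rk (lt m) (insert c' (insert c A)) c') (by omega)
    have hro : Outer lt A c m₀ l h r := ⟨hrB, by omega⟩
    have h1 := hm r hro
    have hlh := hB.left_lt.trans hB.lt_right
    rw [if_neg (by omega), add_zero, hr] at h1
    have := rk_inj (H.linear m) (Finset.mem_insert_of_mem hrB) (Finset.mem_insert_self _ _) h1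
    exact hc' (this ▸ hrB)
  · by_contra hcon
    obtain ⟨r, hrB, hr⟩ := exists_rk_eq (H.linear m₀) (insert c A)
      (i := rk (lt m) (insert c' (insert c A)) c' - 1) (by omega)
    have hro : Outer lt A c m₀ l h r := ⟨hrB, by omega⟩
    have h1 := hm r hro
    rw [if_pos (by omega), hr] at h1
    have := rk_inj (H.linear m) (Finset.mem_insert_of_mem hrB) (Finset.mem_insert_self _ _)
      (h1.trans (by omega))
    exact hc' (this ▸ hrB)

theorem IsBlock.pairEvent_subset {c' : F} (hc' : c' ∉ insert c A) {u v : F}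
    (hu : u ∈ insert c A) (hv : v ∈ insert c A) :
    pairEvent lt A c m₀ l h c' u v ⊆
      (outerEvent lt A c m₀ l h ∩ {m | rk (lt m) (insert c A) u = rk (lt m₀) A c} ∩
        {m | rk (lt m) (insert c A) v = rk (lt m₀) A c + 1}) ∪
      (outerEvent lt A c m₀ l h ∩ {m | rk (lt m) (insert c A) u = rk (lt m₀) A c - 1} ∩
        {m | rk (lt m) (insert c A) v = rk (lt m₀) A c}) := by
  intro m hm
  obtain ⟨hmR, hmu, hmv⟩ := hm
  have hb := hB.rk_le_of_mem_outer H hc' hmR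
  have key : ∀ x ∈ insert c A, rk (lt m) (insert c' (insert c A)) x = rk (lt m) (insert c A) x +
      if rk (lt m) (insert c' (insert c A)) c' < rk (lt m) (insert c' (insert c A)) x
        then 1 else 0 := by
    intro x hx
    have h1 := rk_insert (lt m) hc' x
    rw [lt_iff_rk (H.linear m) (Finset.mem_insert_self _ _) (Finset.mem_insert_of_mem hx)] at h1
    refine h1.trans ?_
    split_ifs <;> rfl
  have hT : m ∈ outerEvent lt A c m₀ l h := by
    intro r hr
    have h1 := key r hr.1
    have h2 := hmR r hr
    have h3 := hr.2
    split_ifs at h1 h2 <;> omega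
  have hu' := key u hu
  have hv' := key v hv
  have hne : ∀ x ∈ insert c A, rk (lt m) (insert c' (insert c A)) x ≠
      rk (lt m) (insert c' (insert c A)) c' := by
    intro x hx hxe
    have := rk_inj (H.linear m) (Finset.mem_insert_of_mem hx) (Finset.mem_insert_self _ _) hxe
    exact hc' (this ▸ hx)
  have h1 := hne u hu
  have h2 := hne v hv
  -- The element `c'` has neither of the two consecutive ranks of `u` and `v`. Deleting it therefore
  -- lowers both ranks by one or leaves both alone. The truncated subtraction is harmless, since in
  -- the first case the lower rank is positive.
  by_cases hlt : rk (lt m) (insert c' (insert c A)) c' < rk (lt m₀) A c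
  · right
    rw [if_pos (by omega)] at hu' hv'
    refine ⟨⟨hT, ?_⟩, ?_⟩
    · change _ = _; omega
    · change _ = _; omega
  · left
    rw [if_neg (by omega)] at hu' hv'
    refine ⟨⟨hT, ?_⟩, ?_⟩
    · change _ = _; omega
    · change _ = _; omega

end Block

/-! ### Overlap of the gap events of two elements in one orbit -/

section Kill

variable {G F M : Type*} [Group G] [MulAction G F] [MulAction G M] {lt : M → F → F → Prop}

section

variable (H : IsOrderFlow G lt) {A : Finset F} {c : F} {m₀ : M} {l q h : ℕ}
  (hB : IsBlock lt A c m₀ l q h)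
include H

theorem IsOrderFlow.agreeOn_smul_of_fix {g : G} {S : Finset F} (hg : ∀ a ∈ S, g • a = a) (m : M) :
    AgreeOn S (lt (g • m)) (lt m) := by
  intro a ha b hb
  rw [← H.smul g m a b, hg a ha, hg b hb]

include hB

/-- The estimate for pairs concerns elements of `insert c A`, whereas `t • c` lies outside. A third
gap `p` allows the adjacent pair to be carried by the group onto two elements of the block, away
from `t • c`. -/
theorem IsBlock.exists_pair {t : G} (ht : ∀ a ∈ A, t • a = a) (hne : t • c ≠ c) {p : ℕ}
    (hp : IsGap lt A c m₀ p) (hp1 : p ≠ rk (lt m₀) A c) (hp2 : p ≠ rk (lt m₀) A c + 1)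
    (hp3 : p + 1 ≠ rk (lt m₀) A c) {e e' : F} (he : e = c ∧ e' = t • c ∨ e = t • c ∧ e' = c)
    {d : M} (hd : d ∈ gapEvent lt A c m₀ l h c) (hd' : d ∈ gapEvent lt A c m₀ l h (t • c))
    (hdp : d ∈ pairEvent lt A c m₀ l h (t • c) e e') :
    ∃ u ∈ inner lt A c m₀ l h, ∃ v ∈ inner lt A c m₀ l h, u ≠ v ∧ ∃ g : G, ∀ m,
      m ∈ pairEvent lt A c m₀ l h (t • c) e e' ↔
        g • m ∈ pairEvent lt A c m₀ l h (t • c) u v := by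
  set c' := t • c with hc'
  have hc : c ∉ A := hB.notMem
  have hc'A : c' ∉ A := by rwa [hc', preserves_of_fix ht]
  have hc'B : c' ∉ insert c A := by
    rw [Finset.mem_insert, not_or]; exact ⟨hne, hc'A⟩
  have htA := preserves_of_fix ht
  -- an isomorphism from `m₀` to `d` on `insert c A`
  obtain ⟨k, hk, hkA⟩ := H.transitive (insert c A) m₀ d
  have hkc : k • c = c := H.fix_of_rk_eq hk hkA (Finset.mem_insert_self _ _) (by
    rw [rk_insert_self (H.linear _) hc, rk_insert_self (H.linear _) hc, hd.1])
  have hkA' := preserves_erase hc hk hkc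
  have hkA0 : AgreeOn A (lt (k • m₀)) (lt d) := hkA.mono (Finset.subset_insert _ _)
  -- an order in which `c'` has the gap `p`
  obtain ⟨mp, hmp, hmpp⟩ := hp
  set x := t • k • mp with hx
  have hxd : AgreeOn A (lt x) (lt d) :=
    ((H.agreeOn_smul_of_fix ht _).trans (H.agreeOn_smul k hkA' hmp)).trans hkA0
  have hxc' : rk (lt x) A c' = p := by
    rw [hx, hc', H.rk_smul t _ htA]
    conv_lhs => rw [← hkc]
    rw [H.rk_smul k _ hkA', hmpp]
  have hxc : l ≤ rk (lt x) A c ∧ rk (lt x) A c ≤ h := by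
    refine hB.bound _ ⟨k⁻¹ • x, ?_, ?_⟩
    · have := H.agreeOn_smul k⁻¹ (preserves_inv hkA') (hxd.trans hkA0.symm)
      rwa [inv_smul_smul] at this
    · conv_lhs => rw [← inv_smul_smul k c, hkc]
      exact H.rk_smul k⁻¹ x (preserves_inv hkA') c
  have hpb := hB.bound p ⟨mp, hmp, hmpp⟩
  -- In `x` and in `d`, both `c` and `c'` lie at positions between `l` and `h` over `A`, so each
  -- outer element has them on the same side in both orders.
  have hrank : ∀ r, Outer lt A c m₀ l h r →
      rk (lt x) (insert c' (insert c A)) r = rk (lt d) (insert c' (insert c A)) r := by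
    intro r hr
    have hrA := hB.mem_of_outer H hr
    have h1 := hB.lt_iff_of_mem_gapEvent H hc hd hr
    have h2 := hB.lt_iff_of_mem_gapEvent H hc'A hd' hr
    have h3 := hd.2 r hr
    have h4 := hr.2
    have h5 := rk_congr hxd hrA
    have h6 := lt_iff_rk_le (H.linear x) hc hrA
    have h7 := lt_iff_rk_le (H.linear x) hc'A hrA
    rw [hxc'] at h7
    rw [rk_insert _ hc] at h3
    have e1 : lt x c r ↔ lt d c r := by
      rw [h6, h1]
      split_ifs at h3 with h8
      · rw [h1] at h8; omega
      · rw [h1] at h8; omega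
    have e2 : lt x c' r ↔ lt d c' r := by
      rw [h7, h2]
      split_ifs at h3 with h8
      · rw [h1] at h8; omega
      · rw [h1] at h8; omega
    rw [rk_insert _ hc'B, rk_insert _ hc, rk_insert _ hc'B, rk_insert _ hc, h5, if_congr e1 rfl rfl,
      if_congr e2 rfl rfl]
  obtain ⟨g, hg, hgA⟩ := H.transitive (insert c' (insert c A)) d x
  have hgR : ∀ r, Outer lt A c m₀ l h r → g • r = r := fun r hr =>
    H.fix_of_rk_eq hg hgA (Finset.mem_insert_of_mem hr.1) (hrank r hr)
  have heD : e ∈ insert c' (insert c A) := by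
    rcases he with ⟨rfl, -⟩ | ⟨rfl, -⟩ <;> simp
  have heD' : e' ∈ insert c' (insert c A) := by
    rcases he with ⟨-, rfl⟩ | ⟨-, rfl⟩ <;> simp
  have hee' : e ≠ e' := by
    rcases he with ⟨rfl, rfl⟩ | ⟨rfl, rfl⟩
    · exact hne.symm
    · exact hne
  have hu := (H.rk_of_agreeOn hg hgA heD).trans hdp.2.1
  have hv := (H.rk_of_agreeOn hg hgA heD').trans hdp.2.2
  -- In `x` the rank of `c'` is `p` or `p + 1`. The three exclusions on `p` keep it away from the
  -- ranks of `g • e` and `g • e'`.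
  have hxD : rk (lt x) (insert c' (insert c A)) c' = p + if lt x c c' then 1 else 0 := by
    rw [rk_insert_self (H.linear x) hc'B, rk_insert _ hc, hxc']
  have hinner : ∀ y, y ∈ insert c' (insert c A) → (y = c ∨ y = c') → g • y ≠ c' →
      g • y ∈ inner lt A c m₀ l h := by
    intro y hy hyc hyc'
    refine mem_inner_of_not_outer ((Finset.mem_insert.1 ((hg y).2 hy)).resolve_left hyc') ?_
    intro ho
    have : g • y = y := MulAction.injective g (hgR _ ho)
    rw [this] at ho
    rcases hyc with rfl | rfl
    · exact hB.not_outer H ho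
    · exact hc'B ho.1
  refine ⟨g • e, hinner e heD ?_ ?_, g • e', hinner e' heD' ?_ ?_,
    fun h' => hee' (MulAction.injective g h'), g, fun m => ?_⟩
  · rcases he with ⟨rfl, -⟩ | ⟨rfl, -⟩ <;> simp
  · intro h'
    rw [h', hxD] at hu
    split_ifs at hu <;> omega
  · rcases he with ⟨-, rfl⟩ | ⟨-, rfl⟩ <;> simp
  · intro h'
    rw [h', hxD] at hv
    split_ifs at hv <;> omega
  · refine and_congr (forall₂_congr fun r hr => ?_) (and_congr ?_ ?_)
    · conv_rhs => lhs; rw [← hgR r hr, H.rk_smul g m hg]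
    · rw [H.rk_smul g m hg]
    · rw [H.rk_smul g m hg]

variable [MeasurableSpace M] (μ : Measure M) [IsProbabilityMeasure μ] [SMulInvariantMeasure G M μ]
  (hmeas : ∀ a b, MeasurableSet {m | lt m a b})
include hmeas

theorem IsBlock.measureReal_inter_pairEvent_le {t : G} (ht : ∀ a ∈ A, t • a = a) (hne : t • c ≠ c)
    {p : ℕ} (hp : IsGap lt A c m₀ p) (hp1 : p ≠ rk (lt m₀) A c) (hp2 : p ≠ rk (lt m₀) A c + 1)
    (hp3 : p + 1 ≠ rk (lt m₀) A c) {e e' : F} (he : e = c ∧ e' = t • c ∨ e = t • c ∧ e' = c) :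
    ((inner lt A c m₀ l h).card * ((inner lt A c m₀ l h).card - 1 : ℝ)) *
      μ.real (gapEvent lt A c m₀ l h c ∩ gapEvent lt A c m₀ l h (t • c) ∩
        pairEvent lt A c m₀ l h (t • c) e e') ≤ 2 * μ.real (outerEvent lt A c m₀ l h) := by
  have hc'B : t • c ∉ insert c A := by
    rw [Finset.mem_insert, not_or, preserves_of_fix ht]
    exact ⟨hne, hB.notMem⟩
  have hn : (1 : ℝ) ≤ (inner lt A c m₀ l h).card := by
    exact_mod_cast Finset.card_pos.2 ⟨c, hB.mem_inner H⟩
  have hn' : 0 ≤ ((inner lt A c m₀ l h).card * ((inner lt A c m₀ l h).card - 1 : ℝ)) :=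
    mul_nonneg (by linarith) (by linarith)
  rcases Set.eq_empty_or_nonempty (gapEvent lt A c m₀ l h c ∩ gapEvent lt A c m₀ l h (t • c) ∩
      pairEvent lt A c m₀ l h (t • c) e e') with hemp | ⟨d, ⟨hd, hd'⟩, hdp⟩
  · rw [hemp, measureReal_empty, mul_zero]
    exact mul_nonneg zero_le_two measureReal_nonneg
  obtain ⟨u, hu, v, hv, huv, g, hg⟩ := hB.exists_pair H ht hne hp hp1 hp2 hp3 he hd hd' hdp
  have huB := (Finset.mem_filter.1 hu).1
  have hvB := (Finset.mem_filter.1 hv).1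
  have h1 : μ.real (gapEvent lt A c m₀ l h c ∩ gapEvent lt A c m₀ l h (t • c) ∩
      pairEvent lt A c m₀ l h (t • c) e e') ≤ μ.real (pairEvent lt A c m₀ l h (t • c) u v) := by
    rw [← measureReal_eq_of_smul μ (measurableSet_pairEvent hmeas A c m₀ l h
      (Finset.mem_insert_of_mem huB) (Finset.mem_insert_of_mem hvB)) g hg]
    exact measureReal_mono Set.inter_subset_right (measure_ne_top _ _)
  have h2 := h1.trans ((measureReal_mono (hB.pairEvent_subset H hc'B huB hvB)
    (measure_ne_top _ _)).trans (measureReal_union_le _ _))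
  have h3 := hB.measureReal_pair_le H μ hmeas hu hv huv (rk (lt m₀) A c) (rk (lt m₀) A c + 1)
  have h4 := hB.measureReal_pair_le H μ hmeas hu hv huv (rk (lt m₀) A c - 1) (rk (lt m₀) A c)
  have h5 := mul_le_mul_of_nonneg_left h2 hn'
  rw [mul_add] at h5
  linarith

/-- The constant `4` counts two relative orders of `c` and `t • c`, each contributing two cases from
the deletion of `t • c`. The bound on the outer event then cancels one factor of the block size. -/
theorem IsBlock.measureReal_gapEvent_inter_le {t : G} (ht : ∀ a ∈ A, t • a = a) (hne : t • c ≠ c)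
    {p : ℕ} (hp : IsGap lt A c m₀ p) (hp1 : p ≠ rk (lt m₀) A c) (hp2 : p ≠ rk (lt m₀) A c + 1)
    (hp3 : p + 1 ≠ rk (lt m₀) A c) :
    ((inner lt A c m₀ l h).card - 1 : ℝ) *
      μ.real (gapEvent lt A c m₀ l h c ∩ gapEvent lt A c m₀ l h (t • c)) ≤
        4 * μ.real (gapEvent lt A c m₀ l h c) := by
  have hc'B : t • c ∉ insert c A := by
    rw [Finset.mem_insert, not_or, preserves_of_fix ht]
    exact ⟨hne, hB.notMem⟩
  have hn : (1 : ℝ) ≤ (inner lt A c m₀ l h).card := by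
    exact_mod_cast Finset.card_pos.2 ⟨c, hB.mem_inner H⟩
  have hn' : 0 ≤ ((inner lt A c m₀ l h).card * ((inner lt A c m₀ l h).card - 1 : ℝ)) :=
    mul_nonneg (by linarith) (by linarith)
  have h1 := hB.measureReal_inter_pairEvent_le H μ hmeas ht hne hp hp1 hp2 hp3
    (e := c) (e' := t • c) (Or.inl ⟨rfl, rfl⟩)
  have h2 := hB.measureReal_inter_pairEvent_le H μ hmeas ht hne hp hp1 hp2 hp3
    (e := t • c) (e' := c) (Or.inr ⟨rfl, rfl⟩)
  have h3 : gapEvent lt A c m₀ l h c ∩ gapEvent lt A c m₀ l h (t • c) ⊆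
      (gapEvent lt A c m₀ l h c ∩ gapEvent lt A c m₀ l h (t • c) ∩
        pairEvent lt A c m₀ l h (t • c) c (t • c)) ∪
      (gapEvent lt A c m₀ l h c ∩ gapEvent lt A c m₀ l h (t • c) ∩
        pairEvent lt A c m₀ l h (t • c) (t • c) c) := by
    intro m hm
    have := hB.mem_pairEvent H hc'B hm.1 hm.2
    rcases (H.linear m).total c (t • c) hne.symm with h' | h'
    · exact Or.inl ⟨hm, this.1 h'⟩
    · exact Or.inr ⟨hm, this.2 h'⟩
  have h4 := (measureReal_mono (μ := μ) h3 (measure_ne_top _ _)).trans (measureReal_union_le _ _)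
  have h5 := mul_le_mul_of_nonneg_left h4 hn'
  have h6 := hB.measureReal_outerEvent_le H μ hmeas
  rw [mul_add] at h5
  have h7 : ((inner lt A c m₀ l h).card : ℝ) * (((inner lt A c m₀ l h).card - 1 : ℝ) *
      μ.real (gapEvent lt A c m₀ l h c ∩ gapEvent lt A c m₀ l h (t • c))) ≤
      (inner lt A c m₀ l h).card * (4 * μ.real (gapEvent lt A c m₀ l h c)) := by
    rw [← mul_assoc]
    linarith
  exact le_of_mul_le_mul_left h7 (by linarith)

end

end Kill

/-! ### A lower bound for the probability of realising a one-point extension -/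

section Kill

variable {G F M : Type*} [Group G] [MulAction G F] [MulAction G M] {lt : M → F → F → Prop}

/-- The orbit of `c` under the pointwise stabilizer of `A`. -/
def stabOrbit (G : Type*) {F : Type*} [Group G] [MulAction G F] (A : Finset F) (c : F) : Set F :=
  {c' | ∃ t : G, (∀ a ∈ A, t • a = a) ∧ t • c = c'}

/-- Some element of the orbit of `c` over `A` lies over `A` as `c` does at `m₀`, up to a permutation
of the block. -/
def killEvent (G : Type*) {F M : Type*} [Group G] [MulAction G F] (lt : M → F → F → Prop)
    (A : Finset F) (c : F) (m₀ : M) (l h : ℕ) : Set M :=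
  ⋃ c' ∈ stabOrbit G A c, gapEvent lt A c m₀ l h c'

/-- The order of `m₀` on `insert c A` is realised over `A` at `m`, where `m` agrees with `m₀`
on `A`. -/
def realiseEvent (G : Type*) {F M : Type*} [Group G] [MulAction G F] [MulAction G M]
    (lt : M → F → F → Prop) (A : Finset F) (c : F) (m₀ : M) : Set M :=
  {m | AgreeOn A (lt m) (lt m₀) ∧
    ∃ g : G, (∀ a ∈ A, g • a = a) ∧ AgreeOn (insert c A) (lt (g • m)) (lt m₀)}

/-- The gaps of `c` over `A`. -/
def gaps (lt : M → F → F → Prop) (A : Finset F) (c : F) (m₀ : M) : Finset ℕ :=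
  (Finset.range (A.card + 1)).filter fun p => IsGap lt A c m₀ p

theorem mem_gaps {A : Finset F} {c : F} {m₀ : M} {p : ℕ} :
    p ∈ gaps lt A c m₀ ↔ IsGap lt A c m₀ p := by
  refine ⟨fun h => (Finset.mem_filter.1 h).2, fun h => Finset.mem_filter.2 ⟨?_, h⟩⟩
  obtain ⟨m, _, rfl⟩ := h
  exact Finset.mem_range.2 (Nat.lt_succ_of_le (Finset.card_filter_le _ _))

theorem measurableSet_agreeOn [MeasurableSpace M] (hmeas : ∀ a b, MeasurableSet {m | lt m a b})
    (B : Finset F) (r : F → F → Prop) : MeasurableSet {m | AgreeOn B (lt m) r} :=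
  measurableSet_of_agreeOn hmeas B _ fun _ _ hmm hm => hmm.symm.trans hm

omit [MulAction G M] in
theorem measurableSet_killEvent [MeasurableSpace M] [Countable F]
    (hmeas : ∀ a b, MeasurableSet {m | lt m a b}) (A : Finset F) (c : F) (m₀ : M) (l h : ℕ) :
    MeasurableSet (killEvent G lt A c m₀ l h) :=
  MeasurableSet.biUnion (Set.to_countable _) fun c' _ => measurableSet_gapEvent hmeas A c m₀ l h c'

variable (H : IsOrderFlow G lt)
include H

/-- The group may be uncountable, but `F` is countable: the event is split according to the element
`g⁻¹ • c`, and each piece depends on a finite part of the order. -/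
theorem IsOrderFlow.measurableSet_realiseEvent [MeasurableSpace M] [Countable F]
    (hmeas : ∀ a b, MeasurableSet {m | lt m a b}) (A : Finset F) (c : F) (m₀ : M) :
    MeasurableSet (realiseEvent G lt A c m₀) := by
  have : realiseEvent G lt A c m₀ = {m | AgreeOn A (lt m) (lt m₀)} ∩
      ⋃ c' ∈ stabOrbit G A c, {m | ∃ g : G, (∀ a ∈ A, g • a = a) ∧ g⁻¹ • c = c' ∧
        AgreeOn (insert c A) (lt (g • m)) (lt m₀)} := by
    ext m
    simp only [realiseEvent, Set.mem_ofPred_eq, Set.mem_inter_iff, Set.mem_iUnion, exists_prop]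
    refine and_congr_right fun _ => ⟨?_, ?_⟩
    · rintro ⟨g, hg, hgA⟩
      exact ⟨_, ⟨g⁻¹, fun a ha => inv_smul_eq_iff.2 (hg a ha).symm, rfl⟩, g, hg, rfl, hgA⟩
    · rintro ⟨_, _, g, hg, _, hgA⟩
      exact ⟨g, hg, hgA⟩
  rw [this]
  refine (measurableSet_agreeOn hmeas A _).inter
    (MeasurableSet.biUnion (Set.to_countable _) fun c' _ => ?_)
  refine measurableSet_of_agreeOn hmeas (insert c' A) _ ?_
  rintro m m' hmm ⟨g, hg, hgc, hgA⟩
  refine ⟨g, hg, hgc, AgreeOn.trans (AgreeOn.symm ?_) hgA⟩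
  refine H.agreeOn_smul g (fun b => ?_) hmm
  rw [Finset.mem_insert, Finset.mem_insert, preserves_of_fix hg, ← hgc, eq_inv_smul_iff]

/-- Every gap of `c` over `A` is filled at some point that agrees with `m₀` on `A`. -/
theorem IsOrderFlow.exists_realise_gaps (A : Finset F) (c : F) (m₀ : M) (P : Finset ℕ)
    (hP : ∀ p ∈ P, IsGap lt A c m₀ p) :
    ∃ m, AgreeOn A (lt m) (lt m₀) ∧ ∀ p ∈ P, ∃ c' ∈ stabOrbit G A c, rk (lt m) A c' = p := by
  induction P using Finset.induction_on with
  | empty => exact ⟨m₀, AgreeOn.refl _ _, by simp⟩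
  | insert p P _ ih =>
    obtain ⟨m, hmA, hmP⟩ := ih fun p' hp' => hP p' (Finset.mem_insert_of_mem hp')
    obtain ⟨mp, hmp, hmpp⟩ := hP p (Finset.mem_insert_self _ _)
    have : Nonempty F := ⟨c⟩
    choose! f hf hfr using hmP
    -- The order on the elements already found is kept while the new gap is filled.
    obtain ⟨m', g, hm', hg, hgA⟩ := H.amalgamation A (A ∪ P.image f) Finset.subset_union_left c m mp
      (hmA.trans hmp.symm)
    refine ⟨m', (hm'.mono Finset.subset_union_left).trans hmA, fun p' hp' => ?_⟩
    rcases Finset.mem_insert.1 hp' with rfl | hp'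
    · refine ⟨g⁻¹ • c, ⟨g⁻¹, fun a ha => inv_smul_eq_iff.2 (hg a ha).symm, rfl⟩, ?_⟩
      rw [← H.rk_smul g m' (preserves_of_fix hg), smul_inv_smul,
        rk_congr_of_subset hgA (Finset.subset_insert _ _) (Finset.mem_insert_self _ _), hmpp]
    · refine ⟨f p', hf p' hp', ?_⟩
      rw [rk_congr_of_subset hm' Finset.subset_union_left
        (Finset.mem_union_right _ (Finset.mem_image_of_mem f hp')), hfr p' hp']

/-- Orbit elements that fill different gaps at a common point are distinct. -/
theorem IsOrderFlow.exists_card_stabOrbit (A : Finset F) (c : F) (m₀ : M) (n : ℕ)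
    (hn : n ≤ (gaps lt A c m₀).card) :
    ∃ E : Finset F, E.card = n ∧ ∀ c' ∈ E, c' ∈ stabOrbit G A c := by
  obtain ⟨m, _, hm⟩ := H.exists_realise_gaps A c m₀ (gaps lt A c m₀) fun p hp => mem_gaps.1 hp
  have : Nonempty F := ⟨c⟩
  choose! f hf hfr using hm
  obtain ⟨P, hP, rfl⟩ := Finset.exists_subset_card_eq hn
  refine ⟨P.image f, Finset.card_image_of_injOn fun p hp p' hp' hpp => ?_, fun c' hc' => ?_⟩
  · rw [← hfr p (hP hp), ← hfr p' (hP hp'), hpp]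
  · obtain ⟨p, hp, rfl⟩ := Finset.mem_image.1 hc'
    exact hf p (hP hp)

section

variable [MeasurableSpace M] (μ : Measure M) [IsProbabilityMeasure μ] [SMulInvariantMeasure G M μ]
  (hmeas : ∀ a b, MeasurableSet {m | lt m a b})
include hmeas

/-- The cylinder over `A` splits according to the position of `c`, and the pieces are cylinders over
`insert c A`, hence of equal mass. -/
theorem IsOrderFlow.measureReal_agreeOn_eq_card_gaps {A : Finset F} {c : F} (hc : c ∉ A) (m₀ : M) :
    μ.real {m | AgreeOn A (lt m) (lt m₀)} =
      (gaps lt A c m₀).card * μ.real {m | AgreeOn (insert c A) (lt m) (lt m₀)} := by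
  have h1 : {m | AgreeOn A (lt m) (lt m₀)} = ⋃ p ∈ gaps lt A c m₀,
      ({m | AgreeOn A (lt m) (lt m₀)} ∩ {m | rk (lt m) A c = p}) := by
    ext m
    simp only [Set.mem_iUnion, Set.mem_inter_iff, Set.mem_ofPred_eq, exists_prop]
    exact ⟨fun h => ⟨_, mem_gaps.2 ⟨m, h, rfl⟩, h, rfl⟩, fun ⟨_, _, h, _⟩ => h⟩
  rw [h1, measureReal_biUnion_finset]
  · rw [← nsmul_eq_mul, ← Finset.sum_const]
    refine Finset.sum_congr rfl fun p hp => ?_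
    obtain ⟨mp, hmp, hmpp⟩ := mem_gaps.1 hp
    rw [H.measureReal_agreeOn_eq μ hmeas (insert c A) m₀ mp]
    congr 1
    ext m
    refine ⟨fun ⟨hm, hmr⟩ => ?_, fun hm => ⟨?_, ?_⟩⟩
    · exact AgreeOn.insert_of_rk (H.linear _) (H.linear _) hc (AgreeOn.trans hm hmp.symm)
        (hmr.trans hmpp.symm)
    · exact AgreeOn.trans (AgreeOn.mono hm (Finset.subset_insert _ _)) hmp
    · exact (rk_congr_of_subset hm (Finset.subset_insert _ _) (Finset.mem_insert_self _ _)).trans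
        hmpp
  · intro p _ p' _ hpp
    exact Set.disjoint_left.2 fun m hm hm' => hpp (hm.2.symm.trans hm'.2)
  · exact fun p _ => (measurableSet_agreeOn hmeas A _).inter (measurableSet_rk_eq hmeas _ _ _)

omit [IsProbabilityMeasure μ] in
-- The ratio of the two events is the same over each order on `A` that meets them: a group element
-- preserving `A` and fixing `c` and the outer elements carries one fibre to the other. If the kill
-- event misses a fibre, so does the smaller gap event.
theorem IsBlock.measureReal_fiber [Countable F] {A : Finset F} {c : F} {m₀ : M} {l q h : ℕ}
    (hB : IsBlock lt A c m₀ l q h) (m₁ : M) :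
    μ.real (killEvent G lt A c m₀ l h ∩ {m | AgreeOn A (lt m) (lt m₁)}) *
        μ.real (gapEvent lt A c m₀ l h c ∩ {m | AgreeOn A (lt m) (lt m₀)}) =
      μ.real (gapEvent lt A c m₀ l h c ∩ {m | AgreeOn A (lt m) (lt m₁)}) *
        μ.real (killEvent G lt A c m₀ l h ∩ {m | AgreeOn A (lt m) (lt m₀)}) := by
  have hsub : gapEvent lt A c m₀ l h c ⊆ killEvent G lt A c m₀ l h := fun m hm =>
    Set.mem_iUnion₂.2 ⟨c, ⟨1, fun a _ => one_smul _ a, one_smul _ c⟩, hm⟩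
  rcases Set.eq_empty_or_nonempty
      (killEvent G lt A c m₀ l h ∩ {m | AgreeOn A (lt m) (lt m₁)}) with hemp | ⟨m, hm, hm₁⟩
  · rw [hemp, Set.subset_eq_empty (Set.inter_subset_inter_left _ hsub) hemp]
    simp
  obtain ⟨_, ⟨t, ht, rfl⟩, hm⟩ := Set.mem_iUnion₂.1 hm
  have hRA : ∀ r, Outer lt A c m₀ l h r → r ∈ A := fun r hr => hB.mem_of_outer H hr
  have hm' : t⁻¹ • m ∈ gapEvent lt A c m₀ l h c := by
    rw [H.smul_mem_gapEvent_iff (preserves_of_fix ht) (fun r hr => ht r (hRA r hr)), smul_inv_smul]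
    exact hm
  obtain ⟨g, hg, hgA⟩ := H.transitive (insert c A) m₀ (t⁻¹ • m)
  have hgR : ∀ r, Outer lt A c m₀ l h r → g • r = r := fun r hr =>
    H.fix_of_rk_eq hg hgA hr.1 (((hB.gapEvent_self H).subset hm').1 r hr)
  have hgc : g • c = c := H.fix_of_rk_eq hg hgA (Finset.mem_insert_self _ _) (by
    rw [rk_insert_self (H.linear _) hB.notMem, rk_insert_self (H.linear _) hB.notMem, hm'.1])
  have hgA' := preserves_erase hB.notMem hg hgc
  have hm₁' : AgreeOn A (lt (g • m₀)) (lt m₁) := by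
    refine (hgA.mono (Finset.subset_insert _ _)).trans (AgreeOn.trans ?_ hm₁)
    exact H.agreeOn_smul_of_fix (fun a ha => inv_smul_eq_iff.2 (ht a ha).symm) m
  have hU : ∀ m, AgreeOn A (lt m) (lt m₀) ↔ AgreeOn A (lt (g • m)) (lt m₁) := by
    refine fun m => ⟨fun h' => (H.agreeOn_smul g hgA' h').trans hm₁', fun h' => ?_⟩
    have := H.agreeOn_smul g⁻¹ (preserves_inv hgA') (h'.trans hm₁'.symm)
    rwa [inv_smul_smul, inv_smul_smul] at this
  have hV := H.smul_mem_gapEvent_iff (m₀ := m₀) (l := l) (h := h) hgA' hgR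
  have hK : ∀ m, m ∈ killEvent G lt A c m₀ l h ↔ g • m ∈ killEvent G lt A c m₀ l h := by
    have key : ∀ (k : G), (∀ b, k • b ∈ A ↔ b ∈ A) → k • c = c → ∀ c' ∈ stabOrbit G A c,
        k • c' ∈ stabOrbit G A c := by
      rintro k hk hkc _ ⟨s, hs, rfl⟩
      refine ⟨k * s * k⁻¹, fun a ha => ?_, ?_⟩
      · rw [mul_smul, mul_smul, hs _ ((preserves_inv hk a).2 ha), smul_inv_smul]
      · rw [mul_smul, mul_smul, inv_smul_eq_iff.2 hkc.symm]
    intro m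
    simp only [killEvent, Set.mem_iUnion, exists_prop]
    constructor
    · rintro ⟨c', hc', hmc⟩
      exact ⟨g • c', key g hgA' hgc c' hc', (hV m c').1 hmc⟩
    · rintro ⟨c', hc', hmc⟩
      refine ⟨g⁻¹ • c', key g⁻¹ (preserves_inv hgA') (inv_smul_eq_iff.2 hgc.symm) c' hc', ?_⟩
      rw [hV, smul_inv_smul]
      exact hmc
  have hKm := measurableSet_killEvent (G := G) hmeas A c m₀ l h
  have hVm := measurableSet_gapEvent hmeas A c m₀ l h c
  have hUm := measurableSet_agreeOn hmeas A (lt m₁)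
  have e1 : μ.real (killEvent G lt A c m₀ l h ∩ {m | AgreeOn A (lt m) (lt m₀)}) =
      μ.real (killEvent G lt A c m₀ l h ∩ {m | AgreeOn A (lt m) (lt m₁)}) :=
    measureReal_eq_of_smul μ (hKm.inter hUm) g fun m => and_congr (hK m) (hU m)
  have e2 : μ.real (gapEvent lt A c m₀ l h c ∩ {m | AgreeOn A (lt m) (lt m₀)}) =
      μ.real (gapEvent lt A c m₀ l h c ∩ {m | AgreeOn A (lt m) (lt m₁)}) := by
    refine measureReal_eq_of_smul μ (hVm.inter hUm) g fun m => and_congr ?_ (hU m)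
    have := hV m c
    rwa [hgc] at this
  rw [e1, e2, mul_comm]

/-- Summing the fibre identities over all orders on `A` passes from the unconditional probability of
the kill event to its probability over the order of `m₀`, where it implies realisation. -/
theorem IsBlock.measureReal_killEvent_mul [Countable F] {A : Finset F} {c : F} {m₀ : M}
    {l q h : ℕ} (hB : IsBlock lt A c m₀ l q h) :
    μ.real (killEvent G lt A c m₀ l h) * μ.real {m | AgreeOn (insert c A) (lt m) (lt m₀)} ≤
      μ.real (gapEvent lt A c m₀ l h c) * μ.real (realiseEvent G lt A c m₀) := by
  have hV : gapEvent lt A c m₀ l h c ∩ {m | AgreeOn A (lt m) (lt m₀)} =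
      {m | AgreeOn (insert c A) (lt m) (lt m₀)} := by
    ext m
    refine ⟨fun ⟨hm, hmA⟩ => AgreeOn.insert_of_rk (H.linear _) (H.linear _) hB.notMem hmA hm.1,
      fun hm => ⟨⟨?_, fun r hr => rk_congr hm hr.1⟩, AgreeOn.mono hm (Finset.subset_insert _ _)⟩⟩
    exact rk_congr_of_subset hm (Finset.subset_insert _ _) (Finset.mem_insert_self _ _)
  have hK : killEvent G lt A c m₀ l h ∩ {m | AgreeOn A (lt m) (lt m₀)} ⊆
      realiseEvent G lt A c m₀ := by
    rintro m ⟨hm, hmA⟩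
    obtain ⟨_, ⟨t, ht, rfl⟩, hm⟩ := Set.mem_iUnion₂.1 hm
    have ht' : ∀ a ∈ A, t⁻¹ • a = a := fun a ha => inv_smul_eq_iff.2 (ht a ha).symm
    refine ⟨hmA, t⁻¹, ht', AgreeOn.insert_of_rk (H.linear _) (H.linear _) hB.notMem
      ((H.agreeOn_smul_of_fix ht' m).trans hmA) ?_⟩
    rw [← hm.1]
    conv_lhs => rw [← inv_smul_smul t c]
    exact H.rk_smul t⁻¹ m (preserves_of_fix ht') _
  have hsum : μ.real (killEvent G lt A c m₀ l h) *
        μ.real (gapEvent lt A c m₀ l h c ∩ {m | AgreeOn A (lt m) (lt m₀)}) =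
      μ.real (gapEvent lt A c m₀ l h c) *
        μ.real (killEvent G lt A c m₀ l h ∩ {m | AgreeOn A (lt m) (lt m₀)}) := by
    rw [measureReal_eq_sum_restr μ hmeas A (measurableSet_killEvent hmeas A c m₀ l h),
      measureReal_eq_sum_restr μ hmeas A (measurableSet_gapEvent hmeas A c m₀ l h c),
      Finset.sum_mul, Finset.sum_mul]
    refine Finset.sum_congr rfl fun x _ => ?_
    by_cases hx : ∃ m, restr A (lt m) = x
    · obtain ⟨m₁, rfl⟩ := hx
      simp_rw [restr_eq_iff]
      exact hB.measureReal_fiber H μ hmeas m₁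
    · have : {m | restr A (lt m) = x} = ∅ := by
        ext m; simpa using fun h => hx ⟨m, h⟩
      simp [this]
  rw [hV] at hsum
  rw [hsum]
  exact mul_le_mul_of_nonneg_left (measureReal_mono hK (measure_ne_top _ _)) measureReal_nonneg

/-- Given the order on `A`, the order of `m₀` on `insert c A` is realised over `A` with probability
bounded below by an absolute constant. -/
theorem IsOrderFlow.measureReal_agreeOn_le [Countable F] {A : Finset F} {c : F} (hc : c ∉ A)
    (m₀ : M) :
    μ.real {m | AgreeOn A (lt m) (lt m₀)} ≤ 32 * μ.real (realiseEvent G lt A c m₀) := by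
  set P := gaps lt A c m₀ with hP
  set β := μ.real {m | AgreeOn (insert c A) (lt m) (lt m₀)} with hβ
  have hβ0 : 0 < β := H.measureReal_agreeOn_pos μ hmeas (insert c A) m₀
  rw [H.measureReal_agreeOn_eq_card_gaps μ hmeas hc m₀, ← hβ, ← hP]
  have hsub : {m | AgreeOn (insert c A) (lt m) (lt m₀)} ⊆ realiseEvent G lt A c m₀ := fun m hm =>
    ⟨AgreeOn.mono hm (Finset.subset_insert _ _), 1, fun a _ => one_smul _ a, by rwa [one_smul]⟩
  have h0 : β ≤ μ.real (realiseEvent G lt A c m₀) := measureReal_mono hsub (measure_ne_top _ _)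
  -- With at most eight gaps, the element `c` alone gives the bound.
  rcases Nat.lt_or_ge P.card 9 with hk | hk
  · have : (P.card : ℝ) ≤ 32 := by exact_mod_cast (by omega : P.card ≤ 32)
    calc (P.card : ℝ) * β ≤ 32 * β := mul_le_mul_of_nonneg_right this hβ0.le
      _ ≤ _ := mul_le_mul_of_nonneg_left h0 (by norm_num)
  have hne : P.Nonempty := Finset.card_pos.1 (by omega)
  set l := P.min' hne with hl
  set h := P.max' hne with hh
  obtain ⟨q, hq⟩ : ((P.erase l).erase h).Nonempty := by
    refine Finset.card_pos.1 ?_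
    have := Finset.pred_card_le_card_erase (s := P.erase l) (a := h)
    have := Finset.pred_card_le_card_erase (s := P) (a := l)
    omega
  rw [Finset.mem_erase, Finset.mem_erase] at hq
  have hB : IsBlock lt A c m₀ l q h :=
    { notMem := hc
      gap_left := mem_gaps.1 (P.min'_mem hne)
      gap_mid := mem_gaps.1 hq.2.2
      gap_right := mem_gaps.1 (P.max'_mem hne)
      left_lt := lt_of_le_of_ne (P.min'_le q hq.2.2) (Ne.symm hq.2.1)
      lt_right := lt_of_le_of_ne (P.le_max' q hq.2.2) hq.1
      bound := fun p hp => ⟨P.min'_le p (mem_gaps.2 hp), P.le_max' p (mem_gaps.2 hp)⟩ }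
  set j := rk (lt m₀) A c with hj
  obtain ⟨p, hp, hp1, hp2, hp3⟩ : ∃ p ∈ P, p ≠ j ∧ p ≠ j + 1 ∧ p + 1 ≠ j := by
    have : (((P.erase j).erase (j + 1)).erase (j - 1)).Nonempty := by
      refine Finset.card_pos.1 ?_
      have := Finset.pred_card_le_card_erase (s := (P.erase j).erase (j + 1)) (a := j - 1)
      have := Finset.pred_card_le_card_erase (s := P.erase j) (a := j + 1)
      have := Finset.pred_card_le_card_erase (s := P) (a := j)
      omega
    obtain ⟨p, hp⟩ := this
    simp only [Finset.mem_erase] at hp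
    exact ⟨p, hp.2.2.2, hp.2.2.1, hp.2.1, by omega⟩
  set L := (inner lt A c m₀ l h).card with hL
  have hPL : P.card ≤ L := by
    have hhB : h < (insert c A).card := by
      obtain ⟨mh, hmh, hmhr⟩ := hB.gap_right
      rw [← hmhr, ← rk_insert_self (H.linear mh) hc]
      exact rk_lt_card (H.linear mh) (Finset.mem_insert_self _ _)
    have h1 : P ⊆ (inner lt A c m₀ l h).image (rk (lt m₀) (insert c A)) := by
      intro p hp
      have hpb := hB.bound p (mem_gaps.1 hp)
      obtain ⟨u, hu, hur⟩ := exists_rk_eq (H.linear m₀) (insert c A) (i := p) (by omega)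
      exact Finset.mem_image.2 ⟨u, Finset.mem_filter.2 ⟨hu, by omega⟩, hur⟩
    exact (Finset.card_le_card h1).trans Finset.card_image_le
  -- The number `n` of orbit elements satisfies `8 * n ≤ L - 1`, so the overlaps in the Bonferroni
  -- bound cost at most half of the main term `n * a`.
  obtain ⟨E, hEc, hE⟩ := H.exists_card_stabOrbit A c m₀ ((P.card - 1) / 8)
    (by rw [← hP]; omega)
  set n := (P.card - 1) / 8 with hn
  set a := μ.real (gapEvent lt A c m₀ l h c) with ha
  have ha0 : 0 < a := by
    refine hβ0.trans_le (measureReal_mono (fun m hm => ⟨?_, fun r hr => rk_congr hm hr.1⟩)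
      (measure_ne_top _ _))
    exact rk_congr_of_subset hm (Finset.subset_insert _ _) (Finset.mem_insert_self _ _)
  have hL1 : (0 : ℝ) < (L : ℝ) - 1 := by
    have : (9 : ℝ) ≤ L := by exact_mod_cast hk.trans hPL
    linarith
  have hVt : ∀ t : G, (∀ x ∈ A, t • x = x) → ∀ m c', m ∈ gapEvent lt A c m₀ l h c' ↔
      t • m ∈ gapEvent lt A c m₀ l h (t • c') := fun t ht m c' =>
    H.smul_mem_gapEvent_iff (preserves_of_fix ht) (fun r hr => ht r (hB.mem_of_outer H hr)) m c'
  have hVm := measurableSet_gapEvent hmeas A c m₀ l h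
  have hbon := bonferroni μ E (gapEvent lt A c m₀ l h) hVm a (4 * a / (L - 1))
    (by positivity) ?_ ?_
  rotate_left
  · intro c' hc'
    obtain ⟨t, ht, rfl⟩ := hE c' hc'
    exact (measureReal_eq_of_smul μ (hVm _) t fun m => hVt t ht m c).symm
  · intro c₁ hc₁ c₂ hc₂ hne
    obtain ⟨t₁, ht₁, rfl⟩ := hE c₁ hc₁
    obtain ⟨t₂, ht₂, rfl⟩ := hE c₂ hc₂
    have hs : ∀ x ∈ A, (t₁⁻¹ * t₂) • x = x := fun x hx => by
      rw [mul_smul, ht₂ x hx, inv_smul_eq_iff, ht₁ x hx]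
    have hsc : (t₁⁻¹ * t₂) • c ≠ c := fun h' => hne (by
      rw [mul_smul, inv_smul_eq_iff] at h'; exact h'.symm)
    have h1 := hB.measureReal_gapEvent_inter_le H μ hmeas hs hsc (mem_gaps.1 hp) hp1 hp2 hp3
    have h2 : μ.real (gapEvent lt A c m₀ l h c ∩ gapEvent lt A c m₀ l h ((t₁⁻¹ * t₂) • c)) =
        μ.real (gapEvent lt A c m₀ l h (t₁ • c) ∩ gapEvent lt A c m₀ l h (t₂ • c)) := by
      refine measureReal_eq_of_smul μ ((hVm (t₁ • c)).inter (hVm (t₂ • c))) t₁ fun m =>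
        and_congr (hVt t₁ ht₁ m c) ?_
      have := hVt t₁ ht₁ m ((t₁⁻¹ * t₂) • c)
      rwa [mul_smul, smul_inv_smul, ← mul_smul] at this
    rw [h2] at h1
    rw [le_div_iff₀ hL1, mul_comm]
    exact h1
  have hKle : μ.real (⋃ c' ∈ E, gapEvent lt A c m₀ l h c') ≤ μ.real (killEvent G lt A c m₀ l h) :=
    measureReal_mono (Set.iUnion₂_subset fun c' hc' => Set.subset_biUnion_of_mem
      (u := fun c' => gapEvent lt A c m₀ l h c') (hE c' hc')) (measure_ne_top _ _)
  have hmul := hB.measureReal_killEvent_mul H μ hmeas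
  rw [← hβ, ← ha] at hmul
  have hnL : 8 * (n : ℝ) ≤ L - 1 := by
    have : 8 * n + 1 ≤ L := by omega
    have : (8 * n + 1 : ℝ) ≤ L := by exact_mod_cast this
    linarith
  -- At least nine gaps give `n ≥ 1`, so `P.card ≤ 8 * n + 8 ≤ 16 * n`. The remaining factor `2` of
  -- `32` is the half lost to overlaps.
  have hPn : (P.card : ℝ) ≤ 16 * n := by exact_mod_cast (by omega : P.card ≤ 16 * n)
  have hb : (n : ℝ) ^ 2 * (4 * a / (L - 1)) ≤ n * a / 2 := by
    rw [mul_div_assoc', div_le_iff₀ hL1]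
    have : (0 : ℝ) ≤ n * a := by positivity
    nlinarith
  rw [hEc] at hbon
  have hK : n * a / 2 ≤ μ.real (killEvent G lt A c m₀ l h) := by linarith
  have h5 : n * a / 2 * β ≤ a * μ.real (realiseEvent G lt A c m₀) :=
    (mul_le_mul_of_nonneg_right hK hβ0.le).trans hmul
  have h6 : a * (n * β) ≤ a * (2 * μ.real (realiseEvent G lt A c m₀)) := by linarith
  have h7 := le_of_mul_le_mul_left h6 ha0
  calc (P.card : ℝ) * β ≤ 16 * n * β := mul_le_mul_of_nonneg_right hPn hβ0.le
    _ ≤ _ := by linarith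

end

end Kill

/-! ### Unique ergodicity and the generic orbit -/

section Generic

variable {G F M : Type*} [Group G] [MulAction G F] [MulAction G M] {lt : M → F → F → Prop}

/-- If `m` agrees with `m₀` on `A`, then the order of `m₀` on `insert c A` is realised over `A`. -/
def extEvent (G : Type*) {F M : Type*} [Group G] [MulAction G F] [MulAction G M]
    (lt : M → F → F → Prop) (A : Finset F) (c : F) (m₀ : M) : Set M :=
  {m | AgreeOn A (lt m) (lt m₀) → m ∈ realiseEvent G lt A c m₀}

/-- The points with the extension property. -/
def genericSet (G : Type*) {F M : Type*} [Group G] [MulAction G F] [MulAction G M]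
    (lt : M → F → F → Prop) : Set M :=
  {m | ∀ A c m₀, m ∈ extEvent G lt A c m₀}

theorem extEvent_congr {A : Finset F} {c : F} {m₀ m₁ : M}
    (h : AgreeOn (insert c A) (lt m₀) (lt m₁)) :
    extEvent G lt A c m₀ = extEvent G lt A c m₁ := by
  have h' := h.mono (Finset.subset_insert c A)
  ext m
  have e1 : AgreeOn A (lt m) (lt m₀) ↔ AgreeOn A (lt m) (lt m₁) :=
    ⟨fun x => x.trans h', fun x => x.trans h'.symm⟩
  refine imp_congr e1 (and_congr e1 (exists_congr fun g => and_congr_right fun _ =>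
    ⟨fun x => x.trans h, fun x => x.trans h.symm⟩))

/-- Only the restriction of `m₀` to a finite set matters, so the intersection is over a countable
family when `F` is countable. -/
theorem genericSet_eq_iInter :
    genericSet G lt = ⋂ (p : Finset F × F) (x : ↥(insert p.2 p.1) → ↥(insert p.2 p.1) → Prop),
      {m | ∀ m₀, restr (insert p.2 p.1) (lt m₀) = x → m ∈ extEvent G lt p.1 p.2 m₀} := by
  ext m
  simp only [genericSet, Set.mem_iInter, Set.mem_ofPred_eq]
  exact ⟨fun h p x m₀ _ => h p.1 p.2 m₀, fun h A c m₀ => h (A, c) _ m₀ rfl⟩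

theorem forall_restr_eq (A : Finset F) (c : F) (x : ↥(insert c A) → ↥(insert c A) → Prop) :
    {m | ∀ m₀, restr (insert c A) (lt m₀) = x → m ∈ extEvent G lt A c m₀} = Set.univ ∨
      ∃ m₀, {m | ∀ m₀, restr (insert c A) (lt m₀) = x → m ∈ extEvent G lt A c m₀} =
        extEvent G lt A c m₀ := by
  by_cases hx : ∃ m₀, restr (insert c A) (lt m₀) = x
  · obtain ⟨m₀, rfl⟩ := hx
    refine Or.inr ⟨m₀, Set.ext fun m => ⟨fun h => h m₀ rfl, fun h m₁ h₁ => ?_⟩⟩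
    rwa [extEvent_congr (restr_eq_iff.1 h₁)]
  · exact Or.inl (Set.eq_univ_of_forall fun m m₀ h => absurd ⟨m₀, h⟩ hx)

variable (H : IsOrderFlow G lt)
include H

/-! #### The extension property holds almost surely -/

/-- A density argument: the bad set has proportion at most `31 / 32` in every set that contains it
and depends on a finite part of the order, and such sets shrink to it in measure. -/
theorem IsOrderFlow.measure_extEvent_compl [Countable F] [MeasurableSpace M] (μ : Measure M)
    [IsProbabilityMeasure μ] [SMulInvariantMeasure G M μ]
    (hmeas : ∀ a b, MeasurableSet {m | lt m a b}) (A : Finset F) (c : F) (m₀ : M) :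
    μ (extEvent G lt A c m₀)ᶜ = 0 := by
  set U := {m | AgreeOn A (lt m) (lt m₀)} with hU
  have hUm : MeasurableSet U := measurableSet_agreeOn hmeas A _
  have hRm := H.measurableSet_realiseEvent hmeas A c m₀
  have hbad : (extEvent G lt A c m₀)ᶜ = U \ realiseEvent G lt A c m₀ := by
    ext m; simp [extEvent, U]
  have hRU : realiseEvent G lt A c m₀ ⊆ U := fun m hm => hm.1
  rw [hbad]
  set Bad := U \ realiseEvent G lt A c m₀ with hBad
  have hBm : MeasurableSet Bad := hUm.diff hRm
  -- the bound on cylinders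
  have key : ∀ C : Finset F, A ⊆ C → ∀ w : M,
      32 * μ.real (Bad ∩ {m | AgreeOn C (lt m) (lt w)}) ≤
        31 * μ.real {m | AgreeOn C (lt m) (lt w)} := by
    intro C hAC w
    rcases Set.eq_empty_or_nonempty (Bad ∩ {m | AgreeOn C (lt m) (lt w)}) with hemp | ⟨m₁, hm₁, hw⟩
    · rw [hemp, measureReal_empty, mul_zero]
      exact mul_nonneg (by norm_num) measureReal_nonneg
    obtain ⟨m₂, g, hC, hg, hgA⟩ := H.amalgamation A C hAC c m₁ m₀ hm₁.1
    have hins : ∀ b, g • b ∈ insert c A ↔ b ∈ insert (g⁻¹ • c) A := fun b => by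
      rw [Finset.mem_insert, Finset.mem_insert, preserves_of_fix hg, eq_inv_smul_iff]
    -- If `g⁻¹ • c` belonged to `C`, the bad point `m₁` would itself realise the extension.
    have hc₁ : g⁻¹ • c ∉ C := by
      intro hcC
      refine hm₁.2 ⟨hm₁.1, g, hg, AgreeOn.trans (H.agreeOn_smul g hins ?_) hgA⟩
      exact hC.symm.mono (Finset.insert_subset hcC hAC)
    have h1 := H.measureReal_agreeOn_le μ hmeas hc₁ m₂
    have h2 : {m | AgreeOn C (lt m) (lt m₂)} = {m | AgreeOn C (lt m) (lt w)} := by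
      ext m
      exact ⟨fun h => (AgreeOn.trans h hC).trans hw, fun h =>
        AgreeOn.trans h (hC.trans hw).symm⟩
    rw [h2] at h1
    -- Realising the larger extension over `C` also realises the original one over `A`, so it
    -- excludes the bad set.
    have h3 : Bad ∩ {m | AgreeOn C (lt m) (lt w)} ⊆
        {m | AgreeOn C (lt m) (lt w)} \ realiseEvent G lt C (g⁻¹ • c) m₂ := by
      rintro m ⟨hmB, hmw⟩
      refine ⟨hmw, ?_⟩
      rintro ⟨hmC, k, hk, hkA⟩
      refine hmB.2 ⟨hmB.1, g * k, fun a ha => ?_, ?_⟩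
      · rw [mul_smul, hk a (hAC ha), hg a ha]
      · rw [mul_smul]
        exact (H.agreeOn_smul g hins (hkA.mono (Finset.insert_subset_insert _ hAC))).trans hgA
    have h4 : realiseEvent G lt C (g⁻¹ • c) m₂ ⊆ {m | AgreeOn C (lt m) (lt w)} := by
      rw [← h2]; exact fun m hm => hm.1
    have h5 := measureReal_mono (μ := μ) h3 (measure_ne_top _ _)
    rw [measureReal_sdiff h4 (H.measurableSet_realiseEvent hmeas _ _ _)] at h5
    linarith
  have key2 : ∀ (C : Finset F) (s : Set M),
      (∀ m m', AgreeOn C (lt m) (lt m') → m ∈ s → m' ∈ s) → Bad ⊆ s →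
        32 * μ.real Bad ≤ 31 * μ.real s := by
    intro C s hs hBs
    have hs' : ∀ m m', AgreeOn (C ∪ A) (lt m) (lt m') → m ∈ s → m' ∈ s := fun m m' h =>
      hs m m' (h.mono Finset.subset_union_left)
    rw [measureReal_eq_sum_restr μ hmeas (C ∪ A) hBm, measureReal_eq_sum_restr μ hmeas (C ∪ A)
      (measurableSet_of_agreeOn hmeas _ s hs'), Finset.mul_sum, Finset.mul_sum]
    refine Finset.sum_le_sum fun x _ => ?_
    rcases Set.eq_empty_or_nonempty (Bad ∩ {m | restr (C ∪ A) (lt m) = x}) with hemp | ⟨m, hm, hmx⟩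
    · rw [hemp, measureReal_empty, mul_zero]
      exact mul_nonneg (by norm_num) measureReal_nonneg
    · rw [Set.mem_ofPred_eq] at hmx
      subst hmx
      simp_rw [restr_eq_iff]
      have : s ∩ {m' | AgreeOn (C ∪ A) (lt m') (lt m)} = {m' | AgreeOn (C ∪ A) (lt m') (lt m)} :=
        Set.inter_eq_right.2 fun m' hm' => hs' m m' (AgreeOn.symm hm') (hBs hm)
      rw [this]
      exact key _ Finset.subset_union_right m
  -- exhaust the complement by cylinders
  let R : Finset F → Set M := fun E => U ∩ {m | ∃ g : G, (∀ a ∈ A, g • a = a) ∧ g⁻¹ • c ∈ E ∧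
    AgreeOn (insert c A) (lt (g • m)) (lt m₀)}
  have hRE : ∀ E m m', AgreeOn (E ∪ A) (lt m) (lt m') → m ∈ R E → m' ∈ R E := by
    rintro E m m' hmm ⟨hm, g, hg, hgE, hgA⟩
    refine ⟨(hmm.symm.mono Finset.subset_union_right).trans hm, g, hg, hgE, ?_⟩
    refine AgreeOn.trans (AgreeOn.symm ?_) hgA
    refine H.agreeOn_smul g (S := insert (g⁻¹ • c) A) (fun b => ?_) (hmm.mono ?_)
    · rw [Finset.mem_insert, Finset.mem_insert, preserves_of_fix hg, eq_inv_smul_iff]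
    · exact Finset.insert_subset (Finset.mem_union_left _ hgE) Finset.subset_union_right
  have hRmono : Monotone R := fun E E' h m ⟨hm, g, hg, hgE, hgA⟩ => ⟨hm, g, hg, h hgE, hgA⟩
  have hRun : realiseEvent G lt A c m₀ = ⋃ E, R E := by
    ext m
    simp only [Set.mem_iUnion]
    exact ⟨fun ⟨hm, g, hg, hgA⟩ => ⟨{g⁻¹ • c}, hm, g, hg, Finset.mem_singleton_self _, hgA⟩,
      fun ⟨E, hm, g, hg, _, hgA⟩ => ⟨hm, g, hg, hgA⟩⟩
  -- The set `U \ R E` contains the bad set and depends only on the order on `E ∪ A`.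
  have h1 : ∀ E, μ (R E) ≤ ENNReal.ofReal (μ.real U - 32 / 31 * μ.real Bad) := by
    intro E
    have hREm : MeasurableSet (R E) := measurableSet_of_agreeOn hmeas _ _ (hRE E)
    have h2 := key2 (E ∪ A) (U \ R E) (fun m m' hmm hm =>
      ⟨(hmm.symm.mono Finset.subset_union_right).trans hm.1, fun h => hm.2 (hRE E m' m hmm.symm h)⟩)
      (Set.sdiff_subset_sdiff_right (by rw [hRun]; exact Set.subset_iUnion R E))
    rw [measureReal_sdiff Set.inter_subset_left hREm] at h2
    rw [← ofReal_measureReal (measure_ne_top _ _)]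
    exact ENNReal.ofReal_le_ofReal (by linarith)
  have h2 : μ (realiseEvent G lt A c m₀) ≤ ENNReal.ofReal (μ.real U - 32 / 31 * μ.real Bad) := by
    rw [hRun, hRmono.directed_le.measure_iUnion]
    exact iSup_le h1
  have hBU := key2 A U (fun m m' hmm hm => hmm.symm.trans hm) Set.sdiff_subset
  have h3 : μ.real (realiseEvent G lt A c m₀) ≤ μ.real U - 32 / 31 * μ.real Bad := by
    refine ENNReal.toReal_le_of_le_ofReal ?_ h2
    linarith [measureReal_nonneg (μ := μ) (s := U)]
  -- Together with `h3` this says that `32 / 31` times the mass of the bad set is at most that mass.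
  have h4 : μ.real Bad = μ.real U - μ.real (realiseEvent G lt A c m₀) := measureReal_sdiff hRU hRm
  have h5 : μ.real Bad = 0 := le_antisymm (by linarith) measureReal_nonneg
  exact (measureReal_eq_zero_iff (measure_ne_top _ _)).1 h5

theorem IsOrderFlow.measure_genericSet [Countable F] [MeasurableSpace M] (μ : Measure M)
    [IsProbabilityMeasure μ] [SMulInvariantMeasure G M μ]
    (hmeas : ∀ a b, MeasurableSet {m | lt m a b}) : μ (genericSet G lt) = 1 := by
  have : ∀ᵐ m ∂μ, m ∈ genericSet G lt := by
    rw [genericSet_eq_iInter]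
    simp only [Set.mem_iInter]
    rw [ae_all_iff]
    intro p
    rw [ae_all_iff]
    intro x
    rcases forall_restr_eq (G := G) (lt := lt) p.1 p.2 x with h | ⟨m₀, h⟩
    · rw [h]; exact ae_of_all _ fun _ => Set.mem_univ _
    · rw [h, ae_iff]
      exact H.measure_extEvent_compl μ hmeas p.1 p.2 m₀
  rw [measure_congr (Filter.eventuallyEq_univ.2 this : genericSet G lt =ᵐ[μ] Set.univ), measure_univ]

end Generic

/-! ### Cylinders as a basis, uniqueness of the measure, and the comeagre orbit -/

section Topology

variable {G F M : Type*} [Group G] [MulAction G F] [MulAction G M] {lt : M → F → F → Prop}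
  [TopologicalSpace M]

theorem isClopen_agreeOn (hclopen : ∀ a b, IsClopen {m | lt m a b}) (B : Finset F)
    (r : F → F → Prop) : IsClopen {m | AgreeOn B (lt m) r} := by
  have : {m | AgreeOn B (lt m) r} = ⋂ a ∈ B, ⋂ b ∈ B, {m | lt m a b ↔ r a b} := by
    ext m; simp [AgreeOn]
  rw [this]
  refine isClopen_biInter_finset fun a _ => isClopen_biInter_finset fun b _ => ?_
  by_cases h : r a b
  · simpa [h] using hclopen a b
  · simp only [h, iff_false]
    exact (hclopen a b).compl

/-- The cylinders form a basis of neighbourhoods. -/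
theorem exists_agreeOn_subset [CompactSpace M] (hclopen : ∀ a b, IsClopen {m | lt m a b})
    (hinj : ∀ m m', (∀ a b, lt m a b ↔ lt m' a b) → m = m') {V : Set M} (hV : IsOpen V) {m : M}
    (hm : m ∈ V) : ∃ C : Finset F, {m' | AgreeOn C (lt m') (lt m)} ⊆ V := by
  obtain ⟨C, hC⟩ := hV.isClosed_compl.isCompact.elim_directed_family_closed
    (fun C : Finset F => {m' | AgreeOn C (lt m') (lt m)})
    (fun C => (isClopen_agreeOn hclopen C _).isClosed) (by
      rw [Set.eq_empty_iff_forall_notMem]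
      rintro m' ⟨hm', h⟩
      rw [Set.mem_iInter] at h
      refine hm' ?_
      rwa [hinj m' m fun a b => h {a, b} a (by simp) b (by simp)])
    (fun C C' => ⟨C ∪ C', fun m' h => AgreeOn.mono h Finset.subset_union_left,
      fun m' h => AgreeOn.mono h Finset.subset_union_right⟩)
  refine ⟨C, fun m' hm' => ?_⟩
  by_contra hcon
  exact Set.eq_empty_iff_forall_notMem.1 hC m' ⟨hcon, hm'⟩

variable (H : IsOrderFlow G lt)
include H

theorem IsOrderFlow.unique_invariant [CompactSpace M] [Countable F] [MeasurableSpace M]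
    [BorelSpace M] (hclopen : ∀ a b, IsClopen {m | lt m a b})
    (hinj : ∀ m m', (∀ a b, lt m a b ↔ lt m' a b) → m = m')
    (μ ν : Measure M) [IsProbabilityMeasure μ] [SMulInvariantMeasure G M μ]
    [IsProbabilityMeasure ν] [SMulInvariantMeasure G M ν] : μ = ν := by
  have hmeas : ∀ a b, MeasurableSet {m | lt m a b} := fun a b => (hclopen a b).isOpen.measurableSet
  let 𝒞 : Set (Set M) := {s | ∃ B : Finset F, ∀ m m', AgreeOn B (lt m) (lt m') → m ∈ s → m' ∈ s}
  have hgen : ‹MeasurableSpace M› = MeasurableSpace.generateFrom 𝒞 := by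
    refine le_antisymm ?_ ?_
    · rw [‹BorelSpace M›.measurable_eq, borel]
      refine MeasurableSpace.generateFrom_le fun V (hV : IsOpen V) => ?_
      -- A countable union of sets, each depending on the order on a single finite set.
      have : V = ⋃ C : Finset F, {m | {m' | AgreeOn C (lt m') (lt m)} ⊆ V} := by
        ext m
        rw [Set.mem_iUnion]
        exact ⟨fun hm => exists_agreeOn_subset hclopen hinj hV hm,
          fun ⟨C, hC⟩ => hC (AgreeOn.refl C (lt m))⟩
      rw [this]
      refine MeasurableSet.iUnion fun C => MeasurableSpace.measurableSet_generateFrom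
        ⟨C, fun m m' hmm hm m'' hm'' => hm (AgreeOn.trans hm'' hmm.symm)⟩
    · refine MeasurableSpace.generateFrom_le ?_
      rintro s ⟨B, hB⟩
      exact measurableSet_of_agreeOn hmeas B s hB
  refine ext_of_generate_finite 𝒞 hgen ?_ ?_ (by simp)
  · rintro s ⟨B, hB⟩ t ⟨B', hB'⟩ _
    exact ⟨B ∪ B', fun m m' h hm => ⟨hB m m' (h.mono Finset.subset_union_left) hm.1,
      hB' m m' (h.mono Finset.subset_union_right) hm.2⟩⟩
  · rintro s ⟨B, hB⟩
    have hs := measurableSet_of_agreeOn hmeas B s hB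
    rcases s.eq_empty_or_nonempty with rfl | ⟨m₀, hm₀⟩
    · simp
    -- every nonempty cylinder over `B` has the same mass
    have key : ∀ (ρ : Measure M) [IsProbabilityMeasure ρ] [SMulInvariantMeasure G M ρ]
        {t : Set M}, (∀ m m', AgreeOn B (lt m) (lt m') → m ∈ t → m' ∈ t) →
        ρ.real t = ((Finset.univ.filter fun x : B → B → Prop =>
          ∃ m ∈ t, restr B (lt m) = x).card : ℝ) * ρ.real {m | AgreeOn B (lt m) (lt m₀)} := by
      intro ρ _ _ t ht
      rw [measureReal_eq_sum_restr ρ hmeas B (measurableSet_of_agreeOn hmeas B t ht),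
        ← nsmul_eq_mul, ← Finset.sum_const, Finset.sum_filter]
      refine Finset.sum_congr rfl fun x _ => ?_
      split_ifs with hx
      · obtain ⟨m, hm, rfl⟩ := hx
        rw [H.measureReal_agreeOn_eq ρ hmeas B m₀ m]
        congr 1
        ext m'
        simp only [restr_eq_iff, Set.mem_inter_iff, Set.mem_ofPred_eq, and_iff_right_iff_imp]
        exact fun h => ht m m' h.symm hm
      · have : t ∩ {m | restr B (lt m) = x} = ∅ := by
          ext m
          simpa using fun hm h => hx ⟨m, hm, h⟩
        rw [this, measureReal_empty]
    have hμ1 := key μ (t := Set.univ) fun _ _ _ _ => Set.mem_univ _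
    have hν1 := key ν (t := Set.univ) fun _ _ _ _ => Set.mem_univ _
    rw [probReal_univ] at hμ1 hν1
    have hn : ((Finset.univ.filter fun x : B → B → Prop =>
        ∃ m ∈ (Set.univ : Set M), restr B (lt m) = x).card : ℝ) ≠ 0 := by
      intro h0
      rw [h0, zero_mul] at hμ1
      exact one_ne_zero hμ1
    have hab := mul_left_cancel₀ hn (hμ1.symm.trans hν1)
    have : μ.real s = ν.real s := by rw [key μ hB, key ν hB, hab]
    exact (measureReal_eq_measureReal_iff (measure_ne_top _ _) (measure_ne_top _ _)).1 this

theorem IsOrderFlow.isOpen_realiseEvent (hclopen : ∀ a b, IsClopen {m | lt m a b}) (A : Finset F)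
    (c : F) (m₀ : M) : IsOpen (realiseEvent G lt A c m₀) := by
  have : realiseEvent G lt A c m₀ = {m | AgreeOn A (lt m) (lt m₀)} ∩
      ⋃ g ∈ {g : G | ∀ a ∈ A, g • a = a}, {m | AgreeOn (insert c A) (lt (g • m)) (lt m₀)} := by
    ext m
    simp [realiseEvent]
  rw [this]
  refine (isClopen_agreeOn hclopen A _).isOpen.inter (isOpen_biUnion fun g _ => ?_)
  exact (isClopen_agreeOn (lt := fun m => lt (g • m)) (fun a b => by
    simp_rw [H.smul_iff]; exact hclopen _ _) _ _).isOpen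

theorem IsOrderFlow.isOpen_extEvent (hclopen : ∀ a b, IsClopen {m | lt m a b}) (A : Finset F)
    (c : F) (m₀ : M) : IsOpen (extEvent G lt A c m₀) := by
  have : extEvent G lt A c m₀ = {m | AgreeOn A (lt m) (lt m₀)}ᶜ ∪ realiseEvent G lt A c m₀ := by
    ext m; simp [extEvent, imp_iff_not_or]
  rw [this]
  exact (isClopen_agreeOn hclopen A _).compl.isOpen.union (H.isOpen_realiseEvent hclopen A c m₀)

/-- Amalgamation changes a point outside a prescribed cylinder condition so that the missing
extension appears. -/
theorem IsOrderFlow.dense_extEvent [CompactSpace M] (hclopen : ∀ a b, IsClopen {m | lt m a b})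
    (hinj : ∀ m m', (∀ a b, lt m a b ↔ lt m' a b) → m = m') (A : Finset F) (c : F) (m₀ : M) :
    Dense (extEvent G lt A c m₀) := by
  refine dense_iff_inter_open.2 fun V hV ⟨m, hm⟩ => ?_
  by_cases hA : AgreeOn A (lt m) (lt m₀)
  · obtain ⟨C, hC⟩ := exists_agreeOn_subset hclopen hinj hV hm
    obtain ⟨m', g, hm', hg, hgA⟩ := H.amalgamation A (C ∪ A) Finset.subset_union_right c m m₀ hA
    exact ⟨m', hC (hm'.mono Finset.subset_union_left), fun h => ⟨h, g, hg, hgA⟩⟩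
  · exact ⟨m, hm, fun h => absurd h hA⟩

theorem IsOrderFlow.isGδ_genericSet [Countable F] (hclopen : ∀ a b, IsClopen {m | lt m a b}) :
    IsGδ (genericSet G lt) := by
  rw [genericSet_eq_iInter]
  refine IsGδ.iInter fun p => IsGδ.iInter fun x => IsOpen.isGδ ?_
  rcases forall_restr_eq (G := G) (lt := lt) p.1 p.2 x with h | ⟨m₀, h⟩
  · rw [h]; exact isOpen_univ
  · rw [h]; exact H.isOpen_extEvent hclopen _ _ _

theorem IsOrderFlow.dense_genericSet [CompactSpace M] [T2Space M] [Countable F]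
    (hclopen : ∀ a b, IsClopen {m | lt m a b})
    (hinj : ∀ m m', (∀ a b, lt m a b ↔ lt m' a b) → m = m') : Dense (genericSet G lt) := by
  rw [genericSet_eq_iInter]
  have key : ∀ (p : Finset F × F) (x : ↥(insert p.2 p.1) → ↥(insert p.2 p.1) → Prop),
      IsOpen {m | ∀ m₀, restr (insert p.2 p.1) (lt m₀) = x → m ∈ extEvent G lt p.1 p.2 m₀} ∧
      Dense {m | ∀ m₀, restr (insert p.2 p.1) (lt m₀) = x → m ∈ extEvent G lt p.1 p.2 m₀} := by
    intro p x
    rcases forall_restr_eq (G := G) (lt := lt) p.1 p.2 x with h | ⟨m₀, h⟩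
    · rw [h]; exact ⟨isOpen_univ, dense_univ⟩
    · rw [h]; exact ⟨H.isOpen_extEvent hclopen _ _ _, H.dense_extEvent hclopen hinj _ _ _⟩
  refine dense_iInter_of_Gδ (fun p => IsGδ.iInter fun x => (key p x).1.isGδ) fun p => ?_
  exact dense_iInter_of_isOpen (fun x => (key p x).1) fun x => (key p x).2

omit [TopologicalSpace M] in
theorem IsOrderFlow.smul_mem_genericSet (g : G) {m : M} (hm : m ∈ genericSet G lt) :
    g • m ∈ genericSet G lt := by
  intro A c m₀ hA
  have hg : ∀ b, g⁻¹ • b ∈ A.image (fun a => g⁻¹ • a) ↔ b ∈ A := fun b => by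
    simp
  have h1 := H.agreeOn_smul g⁻¹ hg hA
  rw [inv_smul_smul] at h1
  obtain ⟨-, k, hk, hkA⟩ := hm (A.image fun a => g⁻¹ • a) (g⁻¹ • c) (g⁻¹ • m₀) h1
  refine ⟨hA, g * k * g⁻¹, fun a ha => ?_, ?_⟩
  · rw [mul_smul, mul_smul, hk _ (Finset.mem_image_of_mem _ ha), smul_inv_smul]
  · have := H.agreeOn_smul g (S' := insert c A) (fun b => ?_) hkA
    · rw [smul_inv_smul] at this
      have e : (g * k * g⁻¹) • g • m = g • k • m := by simp [mul_smul]
      rwa [e]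
    · simp only [Finset.mem_insert, Finset.mem_image, eq_inv_smul_iff, inv_smul_eq_iff]
      simp

/-! #### Back and forth -/

omit [TopologicalSpace M] in
-- One step of back and forth: the extension property of `m'` adds `c` to the domain, and that of
-- `m` adds `d` to the range.
theorem IsOrderFlow.exists_extension {m m' : M} (hm : m ∈ genericSet G lt)
    (hm' : m' ∈ genericSet G lt) (A : Finset F) (g : G)
    (hA : ∀ a ∈ A, ∀ b ∈ A, (lt m a b ↔ lt m' (g • a) (g • b))) (c d : F) :
    ∃ (A' : Finset F) (g' : G), (∀ a ∈ A', ∀ b ∈ A', (lt m a b ↔ lt m' (g' • a) (g' • b))) ∧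
      A ⊆ A' ∧ (∀ a ∈ A, g' • a = g • a) ∧ c ∈ A' ∧ ∃ b ∈ A', g' • b = d := by
  -- extend the domain by `c`
  obtain ⟨g₁, hg₁, hg₁A⟩ : ∃ g₁ : G, (∀ a ∈ A, g₁ • a = g • a) ∧
      ∀ a ∈ insert c A, ∀ b ∈ insert c A, (lt m a b ↔ lt m' (g₁ • a) (g₁ • b)) := by
    have h1 : AgreeOn (A.image fun a => g • a) (lt m') (lt (g • m)) := by
      simp only [AgreeOn, Finset.mem_image]
      rintro _ ⟨a, ha, rfl⟩ _ ⟨b, hb, rfl⟩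
      rw [H.smul, hA a ha b hb]
    obtain ⟨-, k, hk, hkA⟩ := hm' _ (g • c) _ h1
    refine ⟨k⁻¹ * g, fun a ha => ?_, fun a ha b hb => ?_⟩
    · rw [mul_smul, inv_smul_eq_iff, hk _ (Finset.mem_image_of_mem _ ha)]
    · have hmem : ∀ x ∈ insert c A, g • x ∈ insert (g • c) (A.image fun a => g • a) := by
        intro x hx
        rw [← Finset.image_insert]
        exact Finset.mem_image_of_mem _ hx
      rw [← H.smul g m, ← hkA _ (hmem a ha) _ (hmem b hb), H.smul_iff, mul_smul, mul_smul]
  -- extend the range by `d`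
  have h1 : AgreeOn (insert c A) (lt m) (lt (g₁⁻¹ • m')) := by
    intro a ha b hb
    rw [hg₁A a ha b hb, ← H.smul g₁ (g₁⁻¹ • m'), smul_inv_smul]
  obtain ⟨-, k, hk, hkA⟩ := hm _ (g₁⁻¹ • d) _ h1
  have hk' : ∀ x, k • x ∈ insert (g₁⁻¹ • d) (insert c A) ↔
      x ∈ insert (k⁻¹ • g₁⁻¹ • d) (insert c A) := fun x => by
    rw [Finset.mem_insert (s := insert c A), Finset.mem_insert (s := insert c A),
      preserves_of_fix hk, ← smul_eq_iff_eq_inv_smul k]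
  refine ⟨insert (k⁻¹ • g₁⁻¹ • d) (insert c A), g₁ * k, fun a ha b hb => ?_, ?_, fun a ha => ?_,
    ?_, ?_⟩
  · rw [mul_smul, mul_smul, ← H.smul k m, hkA _ ((hk' a).2 ha) _ ((hk' b).2 hb),
      ← H.smul g₁ (g₁⁻¹ • m'), smul_inv_smul]
  · exact (Finset.subset_insert _ _).trans (Finset.subset_insert _ _)
  · rw [mul_smul, hk a (Finset.mem_insert_of_mem ha), hg₁ a ha]
  · exact Finset.mem_insert_of_mem (Finset.mem_insert_self _ _)
  · exact ⟨_, Finset.mem_insert_self _ _, by rw [mul_smul, smul_inv_smul, smul_inv_smul]⟩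

omit [TopologicalSpace M] in
-- Back and forth along an enumeration of `F` produces a bijection that is locally given by group
-- elements. The assumption `hfull` expresses that the image of the group is closed among the
-- permutations of `F`.
theorem IsOrderFlow.exists_smul_eq [Countable F] [Nonempty F]
    (hinj : ∀ m m', (∀ a b, lt m a b ↔ lt m' a b) → m = m')
    (hfull : ∀ f : F → F, Function.Bijective f →
      (∀ A : Finset F, ∃ g : G, ∀ a ∈ A, g • a = f a) → ∃ g : G, ∀ a, g • a = f a)
    {m m' : M} (hm : m ∈ genericSet G lt) (hm' : m' ∈ genericSet G lt) : ∃ g : G, g • m = m' := by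
  obtain ⟨e, he⟩ := exists_surjective_nat F
  let S := {p : Finset F × G // ∀ a ∈ p.1, ∀ b ∈ p.1, (lt m a b ↔ lt m' (p.2 • a) (p.2 • b))}
  have hstep : ∀ (s : S) (n : ℕ), ∃ s' : S, s.1.1 ⊆ s'.1.1 ∧
      (∀ a ∈ s.1.1, s'.1.2 • a = s.1.2 • a) ∧ e n ∈ s'.1.1 ∧ ∃ b ∈ s'.1.1, s'.1.2 • b = e n := by
    rintro ⟨⟨A, g⟩, hA⟩ n
    obtain ⟨A', g', h1, h2, h3, h4, h5⟩ := H.exists_extension hm hm' A g hA (e n) (e n)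
    exact ⟨⟨(A', g'), h1⟩, h2, h3, h4, h5⟩
  choose next hn1 hn2 hn3 hn4 using hstep
  let s : ℕ → S := fun n => Nat.rec ⟨(∅, 1), by simp⟩ (fun n x => next x n) n
  have hs : ∀ n, s (n + 1) = next (s n) n := fun n => rfl
  have hmono : ∀ n k, n ≤ k → (s n).1.1 ⊆ (s k).1.1 ∧
      ∀ a ∈ (s n).1.1, (s k).1.2 • a = (s n).1.2 • a := by
    intro n k hnk
    induction k, hnk using Nat.le_induction with
    | base => exact ⟨subset_rfl, fun _ _ => rfl⟩
    | succ k _ ih =>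
      rw [hs]
      exact ⟨ih.1.trans (hn1 _ _), fun a ha => (hn2 _ _ a (ih.1 ha)).trans (ih.2 a ha)⟩
  have hex : ∀ a, ∃ n, a ∈ (s n).1.1 := fun a => by
    obtain ⟨n, rfl⟩ := he a
    exact ⟨n + 1, by rw [hs]; exact hn3 _ _⟩
  choose N hN using hex
  let f : F → F := fun a => (s (N a)).1.2 • a
  have hf : ∀ n a, a ∈ (s n).1.1 → (s n).1.2 • a = f a := by
    intro n a ha
    rcases le_total n (N a) with h | h
    · exact ((hmono _ _ h).2 a ha).symm
    · exact (hmono _ _ h).2 a (hN a)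
  have hcommon : ∀ A : Finset F, ∃ n, A ⊆ (s n).1.1 := fun A =>
    ⟨A.sup N, fun a ha => (hmono _ _ (Finset.le_sup ha)).1 (hN a)⟩
  have hbij : Function.Bijective f := by
    refine ⟨fun a b hab => ?_, fun d => ?_⟩
    · obtain ⟨n, hn⟩ := hcommon {a, b}
      rw [← hf n a (hn (by simp)), ← hf n b (hn (by simp))] at hab
      exact MulAction.injective _ hab
    · obtain ⟨n, rfl⟩ := he d
      obtain ⟨b, hb, hbd⟩ := hn4 (s n) n
      exact ⟨b, by rw [← hf (n + 1) b hb]; exact hbd⟩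
  obtain ⟨g, hg⟩ := hfull f hbij fun A => by
    obtain ⟨n, hn⟩ := hcommon A
    exact ⟨(s n).1.2, fun a ha => hf n a (hn ha)⟩
  refine ⟨g, hinj _ _ fun a b => ?_⟩
  obtain ⟨n, hn⟩ := hcommon {g⁻¹ • a, g⁻¹ • b}
  have h1 := (s n).2 (g⁻¹ • a) (hn (by simp)) (g⁻¹ • b) (hn (by simp))
  rw [hf n _ (hn (by simp)), hf n _ (hn (by simp)), ← hg, ← hg, smul_inv_smul,
    smul_inv_smul] at h1
  rw [H.smul_iff, h1]

theorem IsOrderFlow.isDenseGδOrbit_genericSet [CompactSpace M] [T2Space M] [Nonempty M]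
    [Countable F] [Nonempty F] (hclopen : ∀ a b, IsClopen {m | lt m a b})
    (hinj : ∀ m m', (∀ a b, lt m a b ↔ lt m' a b) → m = m')
    (hfull : ∀ f : F → F, Function.Bijective f →
      (∀ A : Finset F, ∃ g : G, ∀ a ∈ A, g • a = f a) → ∃ g : G, ∀ a, g • a = f a) :
    IsDenseGδOrbit G (genericSet G lt) := by
  have hd := H.dense_genericSet hclopen hinj
  obtain ⟨m, hm⟩ := hd.nonempty
  refine ⟨⟨m, ?_⟩, hd, H.isGδ_genericSet hclopen⟩
  ext m'
  constructor
  · exact fun hm' => H.exists_smul_eq hinj hfull hm hm'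
  · rintro ⟨g, rfl⟩
    exact H.smul_mem_genericSet g hm

end Topology

/-- In a Baire space two dense `G_δ` sets meet, and orbits that meet coincide. -/
theorem IsDenseGδOrbit.unique {G X : Type*} [Group G] [TopologicalSpace X] [MulAction G X]
    [BaireSpace X] [Nonempty X] {O O' : Set X} (hO : IsDenseGδOrbit G O)
    (hO' : IsDenseGδOrbit G O') : O = O' := by
  obtain ⟨z, hz, hz'⟩ := (hO.dense.inter_of_Gδ hO.isGδ hO'.isGδ hO'.dense).nonempty
  obtain ⟨x, rfl⟩ := hO.isOrbit
  obtain ⟨y, rfl⟩ := hO'.isOrbit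
  rw [← MulAction.orbit_eq_iff.2 hz, MulAction.orbit_eq_iff.2 hz']

/-! ### Order flows from the Ramsey property -/

/-- The Ramsey property of an action: for every finite colouring of the finite subsets of `F`, all
translates of `A` inside a suitable translate of `T` have the same colour. -/
def IsRamseyAction (G F : Type*) [Group G] [MulAction G F] : Prop :=
  ∀ (A T : Finset F) (k : ℕ) (χ : Finset F → Fin k), ∃ g : G, ∀ h h' : G,
    (∀ a ∈ A, h • a ∈ T.image fun a => g • a) → (∀ a ∈ A, h' • a ∈ T.image fun a => g • a) →
    χ (A.image fun a => h • a) = χ (A.image fun a => h' • a)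

section Ramsey

variable {G F M : Type*} [Group G] [MulAction G F] [MulAction G M]

theorem preserves_of_image_eq {g h : G} {A : Finset F}
    (hA : A.image (fun a => g • a) = A.image fun a => h • a) (b : F) :
    (g⁻¹ * h) • b ∈ A ↔ b ∈ A := by
  have h1 : (g⁻¹ * h) • b ∈ A ↔ h • b ∈ A.image fun a => g • a := by
    simp [mul_smul, smul_eq_iff_eq_inv_smul]
  rw [h1, hA]
  simp

theorem IsRamseyAction.exists_common_value (hR : IsRamseyAction G F) {κ : Type*} [Finite κ]
    (p : M → κ) (A T : Finset F) (m : M) :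
    ∃ m' : M, ∀ u u' : G, (∀ a ∈ A, u⁻¹ • a ∈ T) → (∀ a ∈ A, u'⁻¹ • a ∈ T) →
      ∃ h h' : G, (∀ b, h • b ∈ A ↔ b ∈ A) ∧ (∀ b, h' • b ∈ A ↔ b ∈ A) ∧
        p (h • u • m') = p (h' • u' • m') := by
  obtain ⟨k, ⟨e⟩⟩ := Finite.exists_equiv_fin κ
  -- A translate of `A` by `l` is coloured by the value of `p` at `l⁻¹ • m` for a chosen `l`.
  -- Different choices of `l` differ by elements preserving `A`, which accounts for `h` and `h'` in
  -- the conclusion.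
  let χ : Finset F → Fin k := fun S => e (p
    (if h : ∃ g : G, A.image (fun a => g • a) = S then h.choose⁻¹ • m else m))
  have hχ : ∀ g : G, ∃ l : G, A.image (fun a => l • a) = A.image (fun a => g • a) ∧
      χ (A.image fun a => g • a) = e (p (l⁻¹ • m)) := fun g => by
    have h : ∃ l : G, A.image (fun a => l • a) = A.image fun a => g • a := ⟨g, rfl⟩
    exact ⟨h.choose, h.choose_spec, by simp only [χ, dif_pos h]⟩
  obtain ⟨g, hg⟩ := hR A T k χ
  refine ⟨g⁻¹ • m, fun u u' hu hu' => ?_⟩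
  have hmem : ∀ u : G, (∀ a ∈ A, u⁻¹ • a ∈ T) →
      ∀ a ∈ A, (g * u⁻¹) • a ∈ T.image fun a => g • a := fun u hu a ha => by
    rw [mul_smul]; exact Finset.mem_image_of_mem _ (hu a ha)
  have h1 := hg _ _ (hmem u hu) (hmem u' hu')
  obtain ⟨l, hl, hlχ⟩ := hχ (g * u⁻¹)
  obtain ⟨l', hl', hlχ'⟩ := hχ (g * u'⁻¹)
  rw [hlχ, hlχ'] at h1
  refine ⟨l⁻¹ * (g * u⁻¹), l'⁻¹ * (g * u'⁻¹), preserves_of_image_eq hl,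
    preserves_of_image_eq hl', ?_⟩
  simpa [mul_smul] using e.injective h1

variable [TopologicalSpace M] [CompactSpace M] [ContinuousConstSMul G M] [MulAction.IsMinimal G M]

/-- Compactness yields one point that works for all finite `T`. The square of its orbit lies in `R`
and is dense by minimality. -/
theorem IsRamseyAction.mem_of_isClosed (hR : IsRamseyAction G F) {κ : Type*} [Finite κ]
    (p : M → κ) (A : Finset F) {R : Set (M × M)} (hRc : IsClosed R)
    (hp : ∀ (m m' : M) (h h' : G), (∀ b, h • b ∈ A ↔ b ∈ A) → (∀ b, h' • b ∈ A ↔ b ∈ A) →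
      p (h • m) = p (h' • m') → (m, m') ∈ R) (m m' : M) : (m, m') ∈ R := by
  let Z : Finset F → Set M := fun T =>
    {m | ∀ u u' : G, (∀ a ∈ A, u⁻¹ • a ∈ T) → (∀ a ∈ A, u'⁻¹ • a ∈ T) → (u • m, u' • m) ∈ R}
  have hZc : ∀ T, IsClosed (Z T) := fun T => by
    simp only [Z, Set.ofPred_forall]
    refine isClosed_iInter fun u => isClosed_iInter fun u' => isClosed_iInter fun _ =>
      isClosed_iInter fun _ => hRc.preimage ?_
    exact (continuous_const_smul u).prodMk (continuous_const_smul u')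
  have hZne : ∀ T, (Z T).Nonempty := fun T => by
    obtain ⟨x, hx⟩ := hR.exists_common_value p A T m
    refine ⟨x, fun u u' hu hu' => ?_⟩
    obtain ⟨h, h', hh, hh', e⟩ := hx u u' hu hu'
    exact hp _ _ h h' hh hh' e
  have hanti : ∀ {T T'}, T ⊆ T' → Z T' ⊆ Z T := fun hTT x hx u u' hu hu' =>
    hx u u' (fun a ha => hTT (hu a ha)) fun a ha => hTT (hu' a ha)
  obtain ⟨x, hx⟩ := IsCompact.nonempty_iInter_of_directed_nonempty_isCompact_isClosed Z
    (fun T T' => ⟨T ∪ T', hanti Finset.subset_union_left, hanti Finset.subset_union_right⟩)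
    hZne (fun T => (hZc T).isCompact) hZc
  rw [Set.mem_iInter] at hx
  have hd : Dense (MulAction.orbit G x ×ˢ MulAction.orbit G x) :=
    (MulAction.dense_orbit G x).prod (MulAction.dense_orbit G x)
  have hsub : MulAction.orbit G x ×ˢ MulAction.orbit G x ⊆ R := by
    rintro ⟨_, _⟩ ⟨⟨u, rfl⟩, ⟨u', rfl⟩⟩
    refine hx ((A.image fun a => u⁻¹ • a) ∪ A.image fun a => u'⁻¹ • a) u u' ?_ ?_
    · exact fun a ha => Finset.mem_union_left _ (Finset.mem_image_of_mem _ ha)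
    · exact fun a ha => Finset.mem_union_right _ (Finset.mem_image_of_mem _ ha)
  exact closure_minimal hsub hRc (hd (m, m'))

variable {lt : M → F → F → Prop} (H : IsEquivariantOrder G lt)
include H

omit [CompactSpace M] [ContinuousConstSMul G M] [MulAction.IsMinimal G M] in
theorem IsEquivariantOrder.isClopen_agreeOn_smul (hclopen : ∀ a b, IsClopen {m | lt m a b})
    (A : Finset F) (r : F → F → Prop) (g : G) : IsClopen {m | AgreeOn A (lt (g • m)) r} :=
  isClopen_agreeOn (lt := fun m => lt (g • m)) (fun a b => by
    simp_rw [H.smul_iff]; exact hclopen _ _) _ _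

/-- The clopen set `N` of points whose order on `B` can be moved to that of `m'` is invariant under
the setwise stabilizer of `B`. Membership in `N` is a two-valued colour, so it is constant on `M`,
and `m'` belongs to `N`. -/
theorem IsEquivariantOrder.transitive_of_ramsey (hR : IsRamseyAction G F)
    (hclopen : ∀ a b, IsClopen {m | lt m a b}) (B : Finset F) (m m' : M) :
    ∃ g : G, (∀ b, g • b ∈ B ↔ b ∈ B) ∧ AgreeOn B (lt (g • m)) (lt m') := by
  let N : Set M := {x | ∃ g : G, (∀ b, g • b ∈ B ↔ b ∈ B) ∧ AgreeOn B (lt (g • x)) (lt m')}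
  have hN : ∀ (x : M) (h : G), (∀ b, h • b ∈ B ↔ b ∈ B) → (h • x ∈ N ↔ x ∈ N) := by
    intro x h hh
    constructor
    · rintro ⟨g, hg, hgB⟩
      exact ⟨g * h, preserves_mul hg hh, by rwa [mul_smul]⟩
    · rintro ⟨g, hg, hgB⟩
      exact ⟨g * h⁻¹, preserves_mul hg (preserves_inv hh), by rwa [mul_smul, inv_smul_smul]⟩
  have hNB : ∀ x y, AgreeOn B (lt x) (lt y) → x ∈ N → y ∈ N := by
    rintro x y hxy ⟨g, hg, hgB⟩
    exact ⟨g, hg, (H.agreeOn_smul g hg hxy).symm.trans hgB⟩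
  have hNc : IsClopen N := by
    have hopen : ∀ S : Set M, (∀ x y, AgreeOn B (lt x) (lt y) → x ∈ S → y ∈ S) → IsOpen S := by
      intro S hS
      refine isOpen_iff_forall_mem_open.2 fun x hx => ⟨{y | AgreeOn B (lt y) (lt x)},
        fun y hy => hS x y hy.symm hx, (isClopen_agreeOn hclopen B _).isOpen, AgreeOn.refl _ _⟩
    exact ⟨⟨hopen _ fun x y hxy hx hy => hx (hNB y x hxy.symm hy)⟩, hopen _ hNB⟩
  have hcl : IsClosed {q : M × M | q.1 ∈ N ↔ q.2 ∈ N} := by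
    have : {q : M × M | q.1 ∈ N ↔ q.2 ∈ N} = N ×ˢ N ∪ Nᶜ ×ˢ Nᶜ := by
      ext q
      by_cases h1 : q.1 ∈ N <;> by_cases h2 : q.2 ∈ N <;> simp [h1, h2]
    rw [this]
    exact (hNc.isClosed.prod hNc.isClosed).union (hNc.compl.isClosed.prod hNc.compl.isClosed)
  refine (hR.mem_of_isClosed (fun x => x ∈ N) B hcl ?_ m' m).1
    ⟨1, by simp, by rw [one_smul]; exact AgreeOn.refl _ _⟩
  intro x y h h' hh hh' e
  have : (h • x ∈ N) ↔ (h' • y ∈ N) := iff_of_eq e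
  rwa [hN x h hh, hN y h' hh'] at this

theorem IsEquivariantOrder.isOrderFlow (hR : IsRamseyAction G F)
    (hclopen : ∀ a b, IsClopen {m | lt m a b}) : IsOrderFlow G lt where
  toIsEquivariantOrder := H
  transitive := H.transitive_of_ramsey hR hclopen
  amalgamation A C hAC c m m' hA := by
    let N : Set M :=
      {x | ∃ h : G, (∀ b, h • b ∈ A ↔ b ∈ A) ∧ AgreeOn (insert c A) (lt (h • x)) (lt m')}
    have hN : ∀ (x : M) (h : G), (∀ b, h • b ∈ A ↔ b ∈ A) → (h • x ∈ N ↔ x ∈ N) := by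
      intro x h hh
      constructor
      · rintro ⟨g, hg, hgB⟩
        exact ⟨g * h, preserves_mul hg hh, by rwa [mul_smul]⟩
      · rintro ⟨g, hg, hgB⟩
        exact ⟨g * h⁻¹, preserves_mul hg (preserves_inv hh), by rwa [mul_smul, inv_smul_smul]⟩
    -- At the translates `g • x` and `k • x`, resembling `m'` on `insert c A` and `m` on `C`, the
    -- colour agrees.
    obtain ⟨x, hx⟩ := hR.exists_common_value (fun x => x ∈ N) A (insert c C) m
    obtain ⟨g, hg, hgA⟩ := H.transitive_of_ramsey hR hclopen (insert c A) x m'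
    obtain ⟨k, hk, hkC⟩ := H.transitive_of_ramsey hR hclopen C x m
    obtain ⟨h, h', hh, hh', e⟩ := hx g k
      (fun a ha => Finset.insert_subset_insert c hAC
        ((preserves_inv hg a).2 (Finset.mem_insert_of_mem ha)))
      (fun a ha => Finset.mem_insert_of_mem ((preserves_inv hk a).2 (hAC ha)))
    have e' : (h • g • x ∈ N) ↔ (h' • k • x ∈ N) := iff_of_eq e
    rw [hN _ h hh, hN _ h' hh'] at e'
    obtain ⟨l, hl, hlA⟩ := e'.1 ⟨1, by simp, by rwa [one_smul]⟩
    -- The element `l` preserves `A` and keeps the order on it, so it fixes `A` pointwise by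
    -- rigidity.
    refine ⟨k • x, l, hkC, fun a ha => H.fix_of_agreeOn hl (m := k • x) ?_ ha, hlA⟩
    exact (hlA.mono (Finset.subset_insert c A)).trans ((hkC.mono hAC).trans hA).symm

/-- Points with the same order coincide, if continuous functions are almost invariant under
pointwise stabilizers. -/
theorem IsEquivariantOrder.ext_of_ramsey [T2Space M] (hR : IsRamseyAction G F)
    (hclopen : ∀ a b, IsClopen {m | lt m a b})
    (hstab : ∀ f : M → ℝ, Continuous f → ∀ ε > 0, ∃ A : Finset F, ∀ g : G,
      (∀ a ∈ A, g • a = a) → ∀ m, |f (g • m) - f m| ≤ ε)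
    {m₁ m₂ : M} (h12 : ∀ a b, lt m₁ a b ↔ lt m₂ a b) : m₁ = m₂ := by
  by_contra hne
  obtain ⟨f, hf1, hf2, hf⟩ := exists_continuous_zero_one_of_isClosed
    (isClosed_singleton (x := m₁)) (isClosed_singleton (x := m₂)) (by simpa using hne)
  obtain ⟨A, hA⟩ := hstab f f.continuous (1 / 8) (by norm_num)
  choose t ht htA using fun m => H.transitive_of_ramsey hR hclopen A m m₁
  -- up to `1 / 8`, the value `f (h • m)` does not depend on the choice of `h`
  have hind : ∀ (m : M) (h h' : G), (∀ b, h • b ∈ A ↔ b ∈ A) → (∀ b, h' • b ∈ A ↔ b ∈ A) →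
      AgreeOn A (lt (h • m)) (lt m₁) → AgreeOn A (lt (h' • m)) (lt m₁) →
      |f (h • m) - f (h' • m)| ≤ 1 / 8 := by
    intro m h h' hh hh' hm hm'
    have e : (h * h'⁻¹) • h' • m = h • m := by rw [mul_smul, inv_smul_smul]
    have := hA (h * h'⁻¹) (fun a ha => H.fix_of_agreeOn (m := h' • m)
      (preserves_mul hh (preserves_inv hh')) (by rw [e]; exact hm.trans hm'.symm) ha) (h' • m)
    rwa [e] at this
  -- After a point is moved so that its order on `A` is that of `m₁`, its value under `f` is defined
  -- up to `1 / 8`. The colour records this value in steps of `1 / 8`.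
  let p : M → Finset.Icc (0 : ℤ) 8 := fun m => ⟨⌊8 * f (t m • m)⌋, by
    rw [Finset.mem_Icc]
    obtain ⟨h0, h1⟩ := hf (t m • m)
    exact ⟨Int.floor_nonneg.2 (by linarith), Int.cast_le.1 ((Int.floor_le _).trans (by
      push_cast; linarith) : ((⌊8 * f (t m • m)⌋ : ℤ) : ℝ) ≤ ((8 : ℤ) : ℝ))⟩⟩
  have hcl : IsClosed {q : M × M | ∀ h h' : G, (∀ b, h • b ∈ A ↔ b ∈ A) →
      (∀ b, h' • b ∈ A ↔ b ∈ A) → AgreeOn A (lt (h • q.1)) (lt m₁) →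
      AgreeOn A (lt (h' • q.2)) (lt m₁) → |f (h • q.1) - f (h' • q.2)| ≤ 1 / 2} := by
    simp only [Set.ofPred_forall]
    refine isClosed_iInter fun h => isClosed_iInter fun h' => isClosed_iInter fun _ =>
      isClosed_iInter fun _ => ?_
    simp_rw [imp_iff_not_or]
    refine (((H.isClopen_agreeOn_smul hclopen A _ h).compl.isClosed.preimage
      continuous_fst)).union (((H.isClopen_agreeOn_smul hclopen A _ h').compl.isClosed.preimage
      continuous_snd).union ?_)
    have hc1 : Continuous fun q : M × M => f (h • q.1) :=
      f.continuous.comp ((continuous_const_smul h).comp continuous_fst)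
    have hc2 : Continuous fun q : M × M => f (h' • q.2) :=
      f.continuous.comp ((continuous_const_smul h').comp continuous_snd)
    exact isClosed_le (hc1.sub hc2).abs continuous_const
  have := hR.mem_of_isClosed p A hcl ?_ m₁ m₂ 1 1 (by simp) (by simp)
    (by rw [one_smul]; exact AgreeOn.refl _ _)
    (by rw [one_smul]; exact fun a _ b _ => (h12 a b).symm)
  · rw [one_smul, one_smul, hf1 rfl, hf2 rfl] at this
    norm_num at this
  -- Two changes of representative and one rounding step cost `3 / 8` in total, within the tolerance
  -- `1 / 2`, whereas `f` separates `m₁` and `m₂` by `1`.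
  · intro x y h h' hh hh' e k k' hk hk' hkx hky
    have e1 : |8 * f (t (h • x) • h • x) - 8 * f (t (h' • y) • h' • y)| < 1 :=
      Int.abs_sub_lt_one_of_floor_eq_floor (congrArg Subtype.val e)
    have e2 := hind x k (t (h • x) * h) hk (preserves_mul (ht _) hh) hkx (by
      rw [mul_smul]; exact htA _)
    have e3 := hind y k' (t (h' • y) * h') hk' (preserves_mul (ht _) hh') hky (by
      rw [mul_smul]; exact htA _)
    rw [mul_smul] at e2 e3
    rw [abs_le] at e2 e3 ⊢
    rw [abs_lt] at e1
    constructor <;> linarith [e1.1, e1.2, e2.1, e2.2, e3.1, e3.2]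

end Ramsey

/-! ### The flow of linear orders -/

/-- The strict linear orders on `F`. -/
def LinOrders (F : Type*) : Type _ := {r : F → F → Bool // StrictLinear fun a b => r a b = true}

namespace LinOrders

variable {F : Type*}

/-- The order relation. -/
def lt (r : LinOrders F) (a b : F) : Prop := r.1 a b = true

instance : TopologicalSpace (LinOrders F) :=
  inferInstanceAs (TopologicalSpace {r : F → F → Bool // StrictLinear fun a b => r a b = true})

instance : T2Space (LinOrders F) :=
  inferInstanceAs (T2Space {r : F → F → Bool // StrictLinear fun a b => r a b = true})

theorem isClopen_lt (a b : F) : IsClopen {r : LinOrders F | r.lt a b} :=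
  (isClopen_discrete {true}).preimage
    ((continuous_apply_apply a b).comp continuous_subtype_val)

instance : CompactSpace (LinOrders F) := by
  refine isCompact_iff_compactSpace.1 (IsClosed.isCompact ?_)
  have hc : ∀ a b, IsClopen {r : F → F → Bool | r a b = true} := fun a b =>
    (isClopen_discrete {true}).preimage (continuous_apply_apply a b)
  have : {r : F → F → Bool | StrictLinear fun a b => r a b = true} =
      (⋂ a, {r | r a a = true}ᶜ) ∩
      (⋂ a, ⋂ b, ⋂ c, ({r | r a b = true}ᶜ ∪ ({r | r b c = true}ᶜ ∪ {r | r a c = true}))) ∩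
      ⋂ a, ⋂ b, ⋂ _ : a ≠ b, ({r | r a b = true} ∪ {r | r b a = true}) := by
    ext r
    simp only [Set.mem_inter_iff, Set.mem_iInter, Set.mem_union, Set.mem_compl_iff,
      Set.mem_ofPred_eq, ← imp_iff_not_or]
    exact ⟨fun h => ⟨⟨h.irrefl, h.trans⟩, h.total⟩, fun h => ⟨h.1.1, h.1.2, h.2⟩⟩
  change IsClosed {r : F → F → Bool | StrictLinear fun a b => r a b = true}
  rw [this]
  refine ((isClosed_iInter fun a => (hc a a).compl.isClosed).inter
    (isClosed_iInter fun a => isClosed_iInter fun b => isClosed_iInter fun c => ?_)).inter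
    (isClosed_iInter fun a => isClosed_iInter fun b => isClosed_iInter fun _ =>
      (hc a b).isClosed.union (hc b a).isClosed)
  exact (hc a b).compl.isClosed.union ((hc b c).compl.isClosed.union (hc a c).isClosed)

instance : Nonempty (LinOrders F) := by
  refine ⟨⟨fun a b => decide (WellOrderingRel a b), ?_, ?_, ?_⟩⟩
  · intro a
    simpa using irrefl_of WellOrderingRel a
  · intro a b c
    simpa using fun h h' => trans_of WellOrderingRel h h'
  · intro a b hab
    rcases trichotomous_of WellOrderingRel a b with h | h | h
    · simp [h]
    · exact absurd h hab
    · simp [h]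

variable {G : Type*} [Group G] [MulAction G F]

instance : MulAction G (LinOrders F) where
  smul g r := ⟨fun a b => r.1 (g⁻¹ • a) (g⁻¹ • b), fun a => r.2.irrefl _,
    fun a b c => r.2.trans _ _ _, fun a b h => r.2.total _ _ fun h' => h (MulAction.injective _ h')⟩
  one_smul r := Subtype.ext <| funext fun a => funext fun b =>
    congrArg₂ r.1 (by rw [inv_one, one_smul]) (by rw [inv_one, one_smul])
  mul_smul g h r := Subtype.ext <| funext fun a => funext fun b =>
    congrArg₂ r.1 (by rw [mul_inv_rev, mul_smul]) (by rw [mul_inv_rev, mul_smul])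

theorem smul_val (g : G) (r : LinOrders F) (a b : F) :
    (g • r).1 a b = r.1 (g⁻¹ • a) (g⁻¹ • b) := rfl

theorem isEquivariantOrder : IsEquivariantOrder G (lt (F := F)) where
  linear r := r.2
  smul g r a b := by
    rw [lt, smul_val, inv_smul_smul, inv_smul_smul]
    rfl

theorem isFlow [TopologicalSpace G] (hG : ∀ a b : F, IsOpen {g : G | g • a = b}) :
    IsFlow G (LinOrders F) where
  compact := inferInstance
  hausdorff := inferInstance
  continuous_smul := by
    refine ⟨Continuous.subtype_mk (continuous_pi fun a => continuous_pi fun b => ?_) _⟩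
    refine continuous_def.2 fun s _ => ?_
    have : (fun p : G × LinOrders F => p.2.1 (p.1⁻¹ • a) (p.1⁻¹ • b)) ⁻¹' s =
        ⋃ x : F, ⋃ y : F, ({g : G | g • x = a} ∩ {g : G | g • y = b}) ×ˢ
          {r : LinOrders F | r.1 x y ∈ s} := by
      ext ⟨g, r⟩
      simp only [Set.mem_preimage, Set.mem_iUnion, Set.mem_prod, Set.mem_inter_iff,
        Set.mem_ofPred_eq]
      constructor
      · intro h
        exact ⟨g⁻¹ • a, g⁻¹ • b, ⟨smul_inv_smul _ _, smul_inv_smul _ _⟩, h⟩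
      · rintro ⟨x, y, ⟨rfl, rfl⟩, h⟩
        rwa [inv_smul_smul, inv_smul_smul]
    rw [this]
    refine isOpen_iUnion fun x => isOpen_iUnion fun y => ((hG x a).inter (hG y b)).prod ?_
    exact (isOpen_discrete s).preimage
      ((continuous_apply_apply x y).comp continuous_subtype_val)

end LinOrders

/-- Universality maps `M` to a minimal subflow of the flow of linear orders, and the orders are
pulled back along this map. -/
theorem exists_isEquivariantOrder {G F M : Type w} [Group G] [TopologicalSpace G] [MulAction G F]
    (hG : ∀ a b : F, IsOpen {g : G | g • a = b}) [TopologicalSpace M] [MulAction G M]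
    (hM : IsUniversalMinimalFlow G M) :
    ∃ lt : M → F → F → Prop, IsEquivariantOrder G lt ∧ ∀ a b, IsClopen {m | lt m a b} := by
  obtain ⟨Z, hZ⟩ := (LinOrders.isFlow hG).exists_minimal
  obtain ⟨π, hπ, hπG⟩ := hM.universal Z hZ
  have hπ' : Continuous fun m => (π m : LinOrders F) := continuous_subtype_val.comp hπ
  refine ⟨fun m => (π m : LinOrders F).lt, ⟨fun m => (π m : LinOrders F).2, fun g m a b => ?_⟩,
    fun a b => (LinOrders.isClopen_lt a b).preimage hπ'⟩
  rw [hπG, SubMulAction.val_smul]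
  exact LinOrders.isEquivariantOrder.smul g _ a b

/-! ### Automorphism groups -/

section Aut

variable {L : FirstOrder.Language.{u, v}} {F : Type w} [L.Structure F]

instance autMulAction : MulAction (F ≃[L] F) F where
  smul g a := g a
  one_smul _ := rfl
  mul_smul _ _ _ := rfl

theorem isOpen_aut_smul_eq (a b : F) : IsOpen {g : F ≃[L] F | g • a = b} := by
  let _ : TopologicalSpace F := ⊥
  have : DiscreteTopology F := ⟨rfl⟩
  have h : Continuous fun f : F → F => f a := continuous_apply a
  exact ⟨{f | f a = b}, (isOpen_discrete {b}).preimage h, rfl⟩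

theorem exists_stabilizer_subset {U : Set (F ≃[L] F)} (hU : U ∈ nhds (1 : F ≃[L] F)) :
    ∃ A : Finset F, ∀ g : F ≃[L] F, (∀ a ∈ A, g • a = a) → g ∈ U := by
  let _ : TopologicalSpace F := ⊥
  have : DiscreteTopology F := ⟨rfl⟩
  rw [nhds_induced, Filter.mem_comap] at hU
  obtain ⟨V, hV, hVU⟩ := hU
  obtain ⟨W, hWV, hW, h1⟩ := mem_nhds_iff.1 hV
  obtain ⟨A, u, hu, hA⟩ := isOpen_pi_iff.1 hW _ h1
  refine ⟨A, fun g hg => hVU (hWV (hA fun a ha => ?_))⟩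
  have : (g : F → F) a = (1 : F ≃[L] F) a := hg a ha
  change (g : F → F) a ∈ u a
  rw [this]
  exact (hu a ha).2

/-- Compactness of `M` makes continuity at the identity uniform over all points, and neighbourhoods
of the identity contain pointwise stabilizers of finite sets. -/
theorem exists_stabilizer_abs_sub_le {M : Type*} [TopologicalSpace M] [CompactSpace M]
    [MulAction (F ≃[L] F) M] [ContinuousSMul (F ≃[L] F) M] (f : M → ℝ) (hf : Continuous f) (ε : ℝ)
    (hε : 0 < ε) : ∃ A : Finset F, ∀ g : F ≃[L] F, (∀ a ∈ A, g • a = a) →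
      ∀ m, |f (g • m) - f m| ≤ ε := by
  have hev : ∀ᶠ g in nhds (1 : F ≃[L] F), ∀ m ∈ (Set.univ : Set M), |f (g • m) - f m| < ε := by
    refine isCompact_univ.eventually_forall_of_forall_eventually fun m _ => ?_
    have hc : Continuous fun z : (F ≃[L] F) × M => |f (z.1 • z.2) - f z.2| :=
      ((hf.comp continuous_smul).sub (hf.comp continuous_snd)).abs
    refine hc.continuousAt.eventually_lt continuousAt_const ?_
    simpa using hε
  obtain ⟨A, hA⟩ := exists_stabilizer_subset hev
  exact ⟨A, fun g hg m => (hA g hg m (Set.mem_univ m)).le⟩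

/-- Each relation involves finitely many entries, and on these the bijection agrees with an
automorphism. -/
theorem exists_aut_of_locally [L.IsRelational] (f : F → F) (hf : Function.Bijective f)
    (h : ∀ A : Finset F, ∃ g : F ≃[L] F, ∀ a ∈ A, g • a = f a) :
    ∃ g : F ≃[L] F, ∀ a, g • a = f a := by
  refine ⟨⟨Equiv.ofBijective f hf, fun φ => isEmptyElim φ, fun {n} r x => ?_⟩, fun a => rfl⟩
  obtain ⟨g, hg⟩ := h (Finset.univ.image x)
  have : (Equiv.ofBijective f hf).toFun ∘ x = g ∘ x :=
    funext fun i => (hg (x i) (Finset.mem_image_of_mem x (Finset.mem_univ i))).symm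
  rw [this]
  exact g.map_rel r x

/-! ### The Ramsey property of the automorphism group -/

theorem exists_ramseyArrow {K : Set (Bundled.{w} L.Structure)} (hR : IsRamsey K)
    {A B : Bundled.{w} L.Structure} (hA : A ∈ K) (hB : B ∈ K) {k : ℕ} (hk : 2 ≤ k) :
    ∃ C ∈ K, RamseyArrow L k 1 A B C := by
  have h1 : ramseyDegreeIn K A < 2 :=
    lt_of_le_of_lt ((le_iSup₂ (f := fun A (_ : A ∈ K) => ramseyDegreeIn K A) A hA).trans hR.le)
      (by norm_num)
  simp only [ramseyDegreeIn, iInf_lt_iff] at h1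
  obtain ⟨d, hd, hd2⟩ := h1
  have hd1 : d ≤ 1 := by
    have : d < 2 := by exact_mod_cast hd2
    omega
  obtain ⟨C, hC, hCA⟩ := hd B hB k hk
  refine ⟨C, hC, fun χ => ?_⟩
  obtain ⟨B', hB', h⟩ := hCA χ
  exact ⟨B', hB', h.trans hd1⟩

/-- In a relational language finite subsets are substructures. The witness of the partition relation
embeds in `F`, and ultrahomogeneity makes its monochromatic copy of `T` a translate of `T`. -/
theorem isRamseyAction_aut [L.IsRelational] [Countable L.Symbols] [Countable F]
    {K : Set (Bundled.{w} L.Structure)} (hfin : ∀ A ∈ K, Finite A) (hR : IsRamsey K)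
    (hF : FirstOrder.Language.IsFraisseLimit K F) : IsRamseyAction (F ≃[L] F) F := by
  intro A T k χ
  let sA : L.Substructure F := FirstOrder.Language.Substructure.closure L (A : Set F)
  let sT : L.Substructure F := FirstOrder.Language.Substructure.closure L (T : Set F)
  have hsA : sA.FG := FirstOrder.Language.Substructure.fg_closure A.finite_toSet
  have hsT : sT.FG := FirstOrder.Language.Substructure.fg_closure T.finite_toSet
  have hmA : ∀ a, a ∈ sA ↔ a ∈ A := fun a => by
    simp [sA, FirstOrder.Language.Substructure.mem_closure_iff_of_isRelational]
  have hmT : ∀ a, a ∈ sT ↔ a ∈ T := fun a => by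
    simp [sT, FirstOrder.Language.Substructure.mem_closure_iff_of_isRelational]
  have hKA : (⟨sA, inferInstance⟩ : Bundled.{w} L.Structure) ∈ K :=
    hF.age ▸ FirstOrder.Language.age.fg_substructure hsA
  have hKT : (⟨sT, inferInstance⟩ : Bundled.{w} L.Structure) ∈ K :=
    hF.age ▸ FirstOrder.Language.age.fg_substructure hsT
  -- The partition relation needs at least two colours, so two unused ones are added.
  obtain ⟨C, hC, hCT⟩ := exists_ramseyArrow hR hKA hKT (k := k + 2) (by omega)
  have := hfin C hC
  have := Fintype.ofFinite C
  obtain ⟨-, ⟨j⟩⟩ : C ∈ L.age F := hF.age.symm ▸ hC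
  obtain ⟨B', ⟨e⟩, hB'⟩ := hCT fun S =>
    Fin.castAdd 2 (χ ((Finset.univ.filter fun x => x ∈ S.1).image j))
  obtain ⟨g, hg⟩ := hF.ultrahomogeneous sT hsT ((j.comp B'.subtype).comp e.symm.toEmbedding)
  have hgT : ∀ t : sT, g • (t : F) = j (e.symm t) := fun t =>
    (DFunLike.congr_fun hg t).symm
  refine ⟨g, ?_⟩
  -- the copies of `A` in the translate of `T`
  have hcopy : ∀ h : F ≃[L] F, (∀ a ∈ A, h • a ∈ T.image fun a => g • a) →
      ∃ S : copies L sA C, S.1 ≤ B' ∧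
        (Finset.univ.filter fun x => x ∈ S.1).image j = A.image fun a => h • a := by
    intro h hh
    have hpre : ∀ a ∈ A, ∃ x ∈ B', j x = h • a := by
      intro a ha
      obtain ⟨t, ht, hta⟩ := Finset.mem_image.1 (hh a ha)
      exact ⟨e.symm ⟨t, (hmT t).2 ht⟩, (e.symm ⟨t, (hmT t).2 ht⟩).2, by rw [← hgT, ← hta]⟩
    let S : L.Substructure C := (h.toEmbedding.comp sA.subtype).toHom.range.comap j.toHom
    have hS : ∀ x, x ∈ S ↔ ∃ a ∈ A, h • a = j x := by
      intro x
      constructor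
      · rintro ⟨a, ha⟩
        exact ⟨a, (hmA _).1 a.2, ha⟩
      · rintro ⟨a, ha, hx⟩
        exact ⟨⟨a, (hmA a).2 ha⟩, hx⟩
    have hr : (j.comp S.subtype).toHom.range = (h.toEmbedding.comp sA.subtype).toHom.range := by
      ext y
      constructor
      · rintro ⟨x, rfl⟩
        exact x.2
      · rintro ⟨a, rfl⟩
        obtain ⟨x, -, hx⟩ := hpre a ((hmA _).1 a.2)
        exact ⟨⟨x, (hS x).2 ⟨a, (hmA _).1 a.2, hx.symm⟩⟩, hx⟩
    have e1 := (j.comp S.subtype).equivRange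
    have e2 := (h.toEmbedding.comp sA.subtype).equivRange
    rw [hr] at e1
    refine ⟨⟨S, ⟨e2.symm.comp e1⟩⟩, fun x hx => ?_, ?_⟩
    · obtain ⟨a, ha, hax⟩ := (hS x).1 hx
      obtain ⟨y, hy, hya⟩ := hpre a ha
      rwa [← j.injective (hya.trans hax)]
    · ext y
      simp only [Finset.mem_image, Finset.mem_filter, Finset.mem_univ, true_and, hS]
      constructor
      · rintro ⟨x, ⟨a, ha, hax⟩, rfl⟩
        exact ⟨a, ha, hax⟩
      · rintro ⟨a, ha, rfl⟩
        obtain ⟨x, -, hx⟩ := hpre a ha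
        exact ⟨x, ⟨a, ha, hx.symm⟩, hx⟩
  intro h h' hh hh'
  obtain ⟨S, hSB, hS⟩ := hcopy h hh
  obtain ⟨S', hSB', hS'⟩ := hcopy h' hh'
  have := (Set.ncard_le_one (Set.toFinite _)).1 hB' _ ⟨S, hSB, rfl⟩ _ ⟨S', hSB', rfl⟩
  beta_reduce at this
  rw [hS, hS'] at this
  exact Fin.castAdd_injective _ _ this

end Aut

end

end OrderFlow

theorem theorem4p1 {L : FirstOrder.Language.{u, v}} [L.IsRelational] [Countable L.Symbols]
    (K : Set (Bundled.{w} L.Structure)) (hK : IsFraisseClass K) (hR : IsRamsey K)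
    (F : Type w) [L.Structure F] [Countable F] (hF : FirstOrder.Language.IsFraisseLimit K F)
    (M : Type w) [TopologicalSpace M] [MeasurableSpace M] [BorelSpace M] [MulAction (F ≃[L] F) M]
    (hM : IsUniversalMinimalFlow (F ≃[L] F) M)
    (hA : ∃ μ : Measure M, IsInvariantProbability (F ≃[L] F) μ) :
    (∃! μ : Measure M, IsInvariantProbability (F ≃[L] F) μ) ∧
      (∃! O : Set M, IsDenseGδOrbit (F ≃[L] F) O) ∧
      ∀ (μ : Measure M) (O : Set M), IsInvariantProbability (F ≃[L] F) μ →
        IsDenseGδOrbit (F ≃[L] F) O → μ O = 1 := by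
  have := hM.compact
  have := hM.hausdorff
  have := hM.continuous_smul
  have := hM.nonempty
  have := hM.minimal
  have hne : Nonempty F := by
    obtain ⟨C, hC, hC1⟩ := hK.unbounded 1
    obtain ⟨-, ⟨j⟩⟩ : C ∈ L.age F := hF.age.symm ▸ hC
    have : Nonempty C := not_isEmpty_iff.1 fun h => by simp at hC1
    exact this.map j
  have hRam : OrderFlow.IsRamseyAction (F ≃[L] F) F := OrderFlow.isRamseyAction_aut hK.finite hR hF
  obtain ⟨lt, hlt, hclopen⟩ := OrderFlow.exists_isEquivariantOrder OrderFlow.isOpen_aut_smul_eq hM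
  have H := hlt.isOrderFlow hRam hclopen
  have hinj : ∀ m m', (∀ a b, lt m a b ↔ lt m' a b) → m = m' := fun m m' h =>
    hlt.ext_of_ramsey hRam hclopen OrderFlow.exists_stabilizer_abs_sub_le h
  have hO := H.isDenseGδOrbit_genericSet hclopen hinj OrderFlow.exists_aut_of_locally
  refine ⟨?_, ⟨_, hO, fun O' hO' => OrderFlow.IsDenseGδOrbit.unique hO' hO⟩, fun μ O hμ hO' => ?_⟩
  · obtain ⟨μ, hμ⟩ := hA
    refine ⟨μ, hμ, fun ν hν => ?_⟩
    have := hμ.isProbability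
    have := hμ.invariant
    have := hν.isProbability
    have := hν.invariant
    exact H.unique_invariant hclopen hinj ν μ
  · have := hμ.isProbability
    have := hμ.invariant
    rw [OrderFlow.IsDenseGδOrbit.unique hO' hO]
    exact H.measure_genericSet μ fun a b => (hclopen a b).isOpen.measurableSet
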